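/- \textbf{Setting.} Let $K\ge 1$ and let time slots be $1,\dots,T$. The network states $S_1,\dots,S_T$ are i.i.d. with values in a measurable space $\mathcal S$. Let $X_k:\mathcal S\to\{0,1\}$ be measurable ($k\in[K]$), with channel rate $\bar x_k=\mathbb E[X_k(S_t)]$. Let $\mathcal A$ be a countable (e.g. finite) set of actions and $I_k:\mathcal A\to\{0,1\}$. Playing $A_t\in\mathcal A$ in slot $t$ gives the rewards $R_k(S_t,A_t)=X_k(S_t)I_k(A_t)$, and $\overline R_{k,t}[W]=\frac1W\sum_{\tau=t-W+1}^{t}R_k(S_\tau,A_\tau)$ is the short-term throughput. Let $\chi_k>0$ be the throughput requirements and assume Slater's condition: for some $\gamma\in(0,1]$ there is a probability mass function $\sigma$ on $\mathcal A$ with $\bar x_k\sum_{a}\sigma(a)I_k(a)\ge\chi_k+\gamma$ for all $k$. \textbf{Virtual queues.} Let $0<\varepsilon\le\gamma/2$. For arm $k$, delivery requests $\ell=1,2,\dots$ are generated in slots $\tau_k(1)<\tau_k(2)<\cdots$, where $\tau_k(0)=0$ and the interarrival times $\tau_k(\ell+1)-\tau_k(\ell)$, $\ell\ge 0$, are Geometric$(\chi_k+\varepsilon)$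 on $\{1,2,\dots\}$; they are independent over $k$ and $\ell$, and independent of the network states. Requests are served first come, first served: with $\ell_{k,1}=1$, the next-to-depart request $\ell_{k,t}$ departs in slot $t$ if and only if $\tau_k(\ell_{k,t})\le t$ and $R_k(S_t,A_t)=1$, in which case $\ell_{k,t+1}=\ell_{k,t}+1$; otherwise $\ell_{k,t+1}=\ell_{k,t}$. The head-of-line age is $Z_{k,t}=\max\{t-\tau_k(\ell_{k,t}),0\}$. \textbf{Policy.} Let $\eta>0$, let $N_{k,t}=\sum_{\tau<t}I_k(A_\tau)$, let $\tilde x_{k,t}$ be the empirical mean of the rewards $R_k(S_\tau,A_\tau)$ over the slots $\tau<t$ with $I_k(A_\tau)=1$, and let $U_{k,t}=\min\{1,\tilde x_{k,t}+\sqrt{3\log t/(2N_{k,t})}\}$ if $N_{k,t}>0$ and $U_{k,t}=1$ otherwise. The age-based UCB policy plays, in each slot $t$, $$A_t\in\arg\max_{a\in\mathcal A}\sum_{k=1}^K(\eta U_{k,t}+Z_{k,t})I_k(a),$$ with ties broken by any function of the age-augmented history, which consists of the actions and rewards of slots $1,\dots,t-1$ and the head-of-line ages of slots $1,\dots,t$.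 \textbf{Constants.} Let $\bar x_{\min}=\min_k\bar x_k$ and, for $y\in(0,1)^K$, let $$h(y)=-\tfrac{\bar x_{\min}}2\log\bigl(1-\min_k y_k\bigr),\qquad g(y,\theta)=\prod_{k=1}^K\frac{y_ke^{2\theta/\bar x_k}}{1-(1-y_k)e^{2\theta/\bar x_k}},$$ $$f(y)=\min_{0<\theta\le h(y)}\Bigl[\frac{9g(y,\theta)}{\theta^2}\log\Bigl(\frac{32g(y,\theta)}{\theta^2}\Bigr)\Bigr],$$ where $g(y,\theta)=+\infty$ if one of its denominators vanishes (which can happen only at $\theta=h(y)$). Let $$B(\eta,\varepsilon)=\frac{8\log(4/\gamma)}{\gamma\varepsilon}f\bigl((\chi_k)_{k=1}^K\bigr)+\frac4{\gamma\varepsilon}\sum_{k=1}^K\frac1{\chi_k\bar x_k}+\frac{4K\eta}{\gamma\varepsilon}+\frac1\varepsilon .$$ \textbf{Theorem.} If the window size $W\in\mathbb N$ satisfies $W\ge B(\eta,\varepsilon)$, then under the age-based UCB policy $\mathbb E[\overline R_{k,t}[W]]\ge\chi_k$ for every arm $k$ and every slot $t$ with $W\le t\le T$. Moreover $B(\eta,\varepsilon)=O(\eta/\varepsilon)$: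 there is a constant $C$, depending only on $K$, $\gamma$, $(\chi_k)_k$ and $(\bar x_k)_k$, such that $B(\eta,\varepsilon)\le C\,\eta/\varepsilon$ for all $\eta\ge1$ and $\varepsilon>0$. -/

import Mathlib

open MeasureTheory ProbabilityTheory

noncomputable section

namespace AgeBandit

/-! ### Rewards and throughput

Time slots are `1, 2, …, T`.  A scheduling action `a` schedules node `k` iff `I a k = true`, and in
network state `s` the channel of node `k` is on iff `X s k = true`. -/

/-- `R_k(s, a) = X_k(s) I_k(a)`. -/
def reward {K : ℕ} {St Act : Type*} (X : St → Fin K → Bool) (I : Act → Fin K → Bool)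
    (s : St) (a : Act) (k : Fin K) : Bool :=
  X s k && I a k

/-- The rewards of arm `k` over time, along the sample path with states `s` and actions `a`. -/
def rewardPath {K : ℕ} {St Act : Type*} (X : St → Fin K → Bool) (I : Act → Fin K → Bool)
    (s : ℕ → St) (a : ℕ → Act) (k : Fin K) : ℕ → Bool :=
  fun t => reward X I (s t) (a t) k

/-- Short-term throughput `W⁻¹ ∑_{τ = t - W + 1}^{t} r_τ` (used for `t ≥ W`). -/
def throughput (W : ℕ) (r : ℕ → Bool) (t : ℕ) : ℝ :=
  (1 / (W : ℝ)) * ∑ τ ∈ Finset.Icc (t + 1 - W) t, ((r τ).toNat : ℝ)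

/-- Channel rate `x̄_k`, the mean of `X_k` under the law `ν` of the network state. -/
def channelRate {K : ℕ} {St : Type*} [MeasurableSpace St] (ν : Measure St)
    (X : St → Fin K → Bool) (k : Fin K) : ℝ :=
  ∫ s, ((X s k).toNat : ℝ) ∂ν

/-! ### The virtual queue of one arm

`G ℓ` is the interarrival time `τ(ℓ+1) - τ(ℓ)` and `r` is the reward path of the arm. -/

/-- The slot `τ(ℓ)` in which the `ℓ`-th delivery request is generated; `τ(0) = 0`. -/
def arrivalTime (G : ℕ → ℕ) (ℓ : ℕ) : ℕ :=
  ∑ j ∈ Finset.range ℓ, G j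

/-- The next-to-depart delivery request at the beginning of slot `t`, under first-come-first-served
service: it is request `1` at slot `1`; in slot `t ≥ 1` the current one departs iff it has been
generated by slot `t` and the reward is `1`, and then the next request takes its place. -/
def nextToDepart (G : ℕ → ℕ) (r : ℕ → Bool) : ℕ → ℕ
  | 0 => 1
  | t + 1 =>
    if 1 ≤ t ∧ r t = true ∧ arrivalTime G (nextToDepart G r t) ≤ t then nextToDepart G r t + 1
    else nextToDepart G r t

/-- Head-of-line age `[t - τ(ℓ_t)]⁺`; the truncated subtraction is the positive part. -/
def headAge (G : ℕ → ℕ) (r : ℕ → Bool) (t : ℕ) : ℕ :=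
  t - arrivalTime G (nextToDepart G r t)

/-! ### UCB estimates of one arm

`i t` tells whether the arm is scheduled in slot `t`, and `r t` is its reward. -/

/-- `N_t`, the number of slots before `t` in which the arm was scheduled. -/
def playCount (i : ℕ → Bool) : ℕ → ℕ
  | 0 => 0
  | t + 1 => if 1 ≤ t ∧ i t = true then playCount i t + 1 else playCount i t

/-- The running empirical mean of the rewards in the slots where the arm was scheduled. -/
def meanEstimate (i r : ℕ → Bool) : ℕ → ℝ
  | 0 => 0
  | t + 1 =>
    if 1 ≤ t ∧ i t = true then
      (1 / ((playCount i t : ℝ) + 1)) *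
        ((playCount i t : ℝ) * meanEstimate i r t + ((r t).toNat : ℝ))
    else meanEstimate i r t

/-- The UCB estimate `U_t`. -/
def ucb (i r : ℕ → Bool) (t : ℕ) : ℝ :=
  if 0 < playCount i t then
    min 1 (meanEstimate i r t + Real.sqrt (3 * Real.log t / (2 * (playCount i t : ℝ))))
  else 1

/-! ### The age-based UCB policy -/

/-- The objective `∑_k (η U_{k,t} + Z_{k,t}) I_k(b)` of action `b` in slot `t`, along the sample
path with interarrival times `G`, states `s` and actions `a`. -/
def score {K : ℕ} {St Act : Type*} (X : St → Fin K → Bool) (I : Act → Fin K → Bool) (η : ℝ)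
    (G : Fin K → ℕ → ℕ) (s : ℕ → St) (a : ℕ → Act) (t : ℕ) (b : Act) : ℝ :=
  ∑ k, (η * ucb (fun τ => I (a τ) k) (rewardPath X I s a k) t
    + (headAge (G k) (rewardPath X I s a k) t : ℝ)) * ((I b k).toNat : ℝ)

/-- The age-augmented history at slot `t`: the actions and rewards of the slots `1, …, t - 1` and
the head-of-line ages of the slots `1, …, t`. -/
def ageHistory {K : ℕ} {St Act : Type*} (X : St → Fin K → Bool) (I : Act → Fin K → Bool)
    (G : Fin K → ℕ → ℕ) (s : ℕ → St) (a : ℕ → Act) (t : ℕ) :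
    (Finset.Ico 1 t → Act × (Fin K → Bool)) × (Finset.Icc 1 t → Fin K → ℕ) :=
  (fun τ => (a τ, fun k => rewardPath X I s a k τ),
    fun τ k => headAge (G k) (rewardPath X I s a k) τ)

/-- The action process `A` follows the age-based UCB policy with parameter `η` up to the horizon
`T`: each action is a function of the age-augmented history (a discrete variable) and maximizes
the objective.  Ties may be broken by any such function. -/
structure IsAgeBasedUCB {K : ℕ} {Ω St Act : Type*} (X : St → Fin K → Bool)
    (I : Act → Fin K → Bool) (η : ℝ) (T : ℕ) (S : ℕ → Ω → St) (G : Fin K → ℕ → Ω → ℕ)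
    (A : ℕ → Ω → Act) : Prop where
  ageBased : ∀ t ∈ Finset.Icc 1 T, Function.FactorsThrough (A t)
    (fun ω => ageHistory X I (fun k ℓ => G k ℓ ω) (fun τ => S τ ω) (fun τ => A τ ω) t)
  argmax : ∀ t ∈ Finset.Icc 1 T, ∀ ω, IsMaxOn
    (score X I η (fun k ℓ => G k ℓ ω) (fun τ => S τ ω) (fun τ => A τ ω) t) Set.univ (A t ω)

/-! ### The random environment -/

/-- `Y` is geometric with success probability `p` and support `{1, 2, …}`. -/
def IsGeometric {Ω : Type*} [MeasurableSpace Ω] (P : Measure Ω) (p : ℝ) (Y : Ω → ℕ) : Prop :=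
  ∀ n : ℕ, P {ω | Y ω = n + 1} = ENNReal.ofReal ((1 - p) ^ n * p)

/-- The network states `S 1, …, S T` are i.i.d. with law `ν`; the interarrival times `G k ℓ` of the
delivery requests are independent over arms and requests, geometric with parameter `p k`; and the
arrivals are independent of the network states. -/
structure IsEnvironment {K : ℕ} {Ω St : Type*} [MeasurableSpace Ω] [MeasurableSpace St]
    (P : Measure Ω) (ν : Measure St) (p : Fin K → ℝ) (T : ℕ) (S : ℕ → Ω → St)
    (G : Fin K → ℕ → Ω → ℕ) : Prop where
  state_measurable : ∀ t ∈ Finset.Icc 1 T, Measurable (S t)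
  state_law : ∀ t ∈ Finset.Icc 1 T, P.map (S t) = ν
  state_indep : iIndepFun (fun t : Finset.Icc 1 T => S t) P
  gap_measurable : ∀ k ℓ, Measurable (G k ℓ)
  gap_law : ∀ k ℓ, IsGeometric P (p k) (G k ℓ)
  gap_indep : iIndepFun (fun q : Fin K × ℕ => G q.1 q.2) P
  indep : IndepFun (fun ω (t : Finset.Icc 1 T) => S t ω) (fun ω (q : Fin K × ℕ) => G q.1 q.2 ω) P

/-! ### The window size -/

/-- `h(y) = -(x̄_min / 2) log (1 - min_k y_k)`. -/
def thetaMax {K : ℕ} (x y : Fin K → ℝ) : ℝ :=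
  -((⨅ k, x k) / 2) * Real.log (1 - ⨅ k, y k)

/-- `g(y, θ) = ∏_k y_k e^{2θ/x̄_k} / (1 - (1 - y_k) e^{2θ/x̄_k})`. -/
def mgfProd {K : ℕ} (x y : Fin K → ℝ) (θ : ℝ) : ℝ :=
  ∏ k, y k * Real.exp (2 * θ / x k) / (1 - (1 - y k) * Real.exp (2 * θ / x k))

/-- `f(y) = min_{0 < θ ≤ h(y)} (9 g(y, θ) / θ²) log (32 g(y, θ) / θ²)`.  For `0 < θ ≤ h(y)` the
denominators in `g` are nonnegative; where one of them vanishes `g` is infinite (not Lean's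
`c / 0 = 0`), so such a `θ` (at most `θ = h(y)`) is left out of the minimum. -/
def windowConst {K : ℕ} (x y : Fin K → ℝ) : ℝ :=
  sInf ((fun θ : ℝ => 9 * mgfProd x y θ / θ ^ 2 * Real.log (32 * mgfProd x y θ / θ ^ 2)) ''
    {θ : ℝ | 0 < θ ∧ θ ≤ thetaMax x y ∧ ∀ k, 0 < 1 - (1 - y k) * Real.exp (2 * θ / x k)})

/-- The lower bound on the window size, for channel rates `x` and requirements `χ`. -/
def windowBound {K : ℕ} (x χ : Fin K → ℝ) (γ η ε : ℝ) : ℝ :=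
  8 * Real.log (4 / γ) / (γ * ε) * windowConst x χ
    + 4 / (γ * ε) * ∑ k, 1 / (χ k * x k) + 4 * K * η / (γ * ε) + 1 / ε

end AgeBandit

end

namespace AgeBandit

/-! ### Elementary inequalities -/

/-! Write `p_k = χ_k + ε`, let `x_k` be the channel rate, `ℓ` the next-to-depart request, `τ(ℓ)` its
arrival slot and `Z` its age. The proof bounds the mean age uniformly in time and then converts this
bound into throughput by counting departures.

Ages: the Lyapunov function is `φ = √(∑ (p_k / x_k) Z_k²)`. A reward removes one gap of mean `1 /
p_k` from the age, so with these weights the mean change of `φ²` is at most `2 ∑ Z_k (p_k / x_k -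
I_k)` plus a constant. The policy maximizes `∑ (η U_k + Z_k) I_k` with `0 ≤ U_k ≤ 1`, so up to `K η`
it does as well for `∑ Z_k I_k` as Slater's distribution (`sum_headAge_mul_le`). That distribution
schedules arm `k` with probability at least `(p_k + γ/2) / x_k`, so `φ` has mean drift at most
`-γ/4` once `φ ≥ a₀ = (4/γ)(K η + ∑ 1/(χ_k x_k))`. The accuracy of the estimates plays no role. The
jumps of `φ` are dominated by sums of geometric gaps, so a Hajek-type argument bounds an exponential
moment of `φ` (`lintegral_exp_ageNorm_le`), and Jensen's inequality bounds `E φ`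
(`lintegral_ageNorm_le`).

Throughput: the gap behind the head-of-line request is independent of everything used so far, so
Wald's identity gives `E ℓ = p_k E τ(ℓ)` (`lintegral_headIndex_eq`). As `Z ≥ t - τ(ℓ)` and `p_k Z_k
≤ φ`, the mean position after the window is at least `p_k (t + 1) - E φ`. Before the window it is at
most `1 + p_k (t - W)`, since requests depart after they arrive. Every departure costs a reward, so
the window earns at least `p_k W - E φ - 1` on average, which is at least `χ_k W` when `ε W ≥ E φ +
1`. -/

lemma exp_le_one_add_add_sq_mul (u : ℝ) : Real.exp u ≤ 1 + u + u ^ 2 * Real.exp |u| := by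
  have h := Complex.norm_exp_sub_sum_le_norm_mul_exp (u : ℂ) 2
  have h1 : Complex.exp (u : ℂ) - ∑ m ∈ Finset.range 2, (u : ℂ) ^ m / (m.factorial : ℂ)
      = ((Real.exp u - (1 + u) : ℝ) : ℂ) := by
    simp [Finset.sum_range_succ]
  rw [h1, Complex.norm_real, Complex.norm_real, Real.norm_eq_abs, Real.norm_eq_abs, sq_abs] at h
  linarith [le_abs_self (Real.exp u - (1 + u))]

/-- The second-order remainder is rescaled from `r` to `θ`: `(r δ)² = (r/θ)² (θ δ)²`, where `(θ δ)²
≤ 2 exp (θ y)`, and the remaining exponential costs another `exp (θ y)`. The error is thus quadratic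
in `r` and needs only the exponential moment at `2 θ`. -/
lemma exp_mul_le_of_abs_le {r θ δ y : ℝ} (hr : 0 ≤ r) (hθ : 0 < θ) (hrθ : r ≤ θ)
    (hδ : |δ| ≤ y) :
    Real.exp (r * δ) ≤ 1 + r * δ + 2 * (r / θ) ^ 2 * Real.exp (2 * θ * y) := by
  have hy : 0 ≤ y := (abs_nonneg δ).trans hδ
  have h1 := exp_le_one_add_add_sq_mul (r * δ)
  have h2 : (r * δ) ^ 2 ≤ (r / θ) ^ 2 * (2 * Real.exp (θ * y)) := by
    have hq := Real.quadratic_le_exp_of_nonneg (x := θ * y) (by positivity)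
    have h3 : (θ * y) ^ 2 ≤ 2 * Real.exp (θ * y) := by
      have : 0 ≤ θ * y := by positivity
      linarith
    have h4 : δ ^ 2 ≤ y ^ 2 := by rw [← sq_abs δ]; gcongr
    calc (r * δ) ^ 2 = r ^ 2 * δ ^ 2 := by ring
      _ ≤ r ^ 2 * y ^ 2 := by gcongr
      _ = (r / θ) ^ 2 * (θ * y) ^ 2 := by field_simp
      _ ≤ _ := by gcongr
  have h5 : Real.exp |r * δ| ≤ Real.exp (θ * y) := by
    rw [abs_mul, abs_of_nonneg hr]; gcongr
  have h6 : (r * δ) ^ 2 * Real.exp |r * δ| ≤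
      (r / θ) ^ 2 * (2 * Real.exp (θ * y)) * Real.exp (θ * y) := by gcongr
  have h7 : Real.exp (2 * θ * y) = Real.exp (θ * y) * Real.exp (θ * y) := by
    rw [← Real.exp_add]; ring_nf
  rw [h7]; linarith

/-! ### Geometric laws on `{1, 2, …}` -/

/-- The measure `m` on `ℕ` is the geometric law with parameter `p` on `{1, 2, …}`. -/
structure GeomLaw (p : ℝ) (m : Measure ℕ) : Prop where
  zero : m {0} = 0
  succ : ∀ n : ℕ, m {n + 1} = ENNReal.ofReal ((1 - p) ^ n * p)

lemma GeomLaw.lintegral_eq {p : ℝ} {m : Measure ℕ} (h : GeomLaw p m) (f : ℕ → ENNReal) :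
    ∫⁻ n, f n ∂m = ∑' n, f (n + 1) * ENNReal.ofReal ((1 - p) ^ n * p) := by
  rw [lintegral_countable', tsum_eq_zero_add' ENNReal.summable, h.zero, mul_zero, zero_add]
  simp_rw [h.succ]

lemma GeomLaw.lintegral_ofReal {p : ℝ} {m : Measure ℕ} (h : GeomLaw p m) (hp : 0 ≤ p)
    (hp1 : p ≤ 1) {f : ℕ → ℝ} (hf : ∀ n, 0 ≤ f n) {a : ℝ}
    (ha : HasSum (fun n => f (n + 1) * ((1 - p) ^ n * p)) a) :
    ∫⁻ n, ENNReal.ofReal (f n) ∂m = ENNReal.ofReal a := by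
  rw [h.lintegral_eq, ← ha.tsum_eq, ENNReal.ofReal_tsum_of_nonneg _ ha.summable]
  · simp_rw [ENNReal.ofReal_mul (hf _)]
  · intro n
    have : 0 ≤ 1 - p := by linarith
    have := hf (n + 1)
    positivity

lemma GeomLaw.integrable_and_integral {p : ℝ} {m : Measure ℕ} (h : GeomLaw p m) (hp : 0 ≤ p)
    (hp1 : p ≤ 1) {f : ℕ → ℝ} (hf : ∀ n, 0 ≤ f n) {a : ℝ}
    (ha : HasSum (fun n => f (n + 1) * ((1 - p) ^ n * p)) a) :
    Integrable f m ∧ ∫ n, f n ∂m = a := by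
  have hl := h.lintegral_ofReal hp hp1 hf ha
  have ha0 : 0 ≤ a := ha.nonneg fun n => by
    have : 0 ≤ 1 - p := by linarith
    have := hf (n + 1)
    positivity
  have hm : AEStronglyMeasurable f m := (measurable_of_countable f).aestronglyMeasurable
  have hi : Integrable f m := by
    rw [← lintegral_ofReal_ne_top_iff_integrable hm (ae_of_all _ hf), hl]
    exact ENNReal.ofReal_ne_top
  refine ⟨hi, ?_⟩
  rw [integral_eq_lintegral_of_nonneg_ae (ae_of_all _ hf) hm, hl, ENNReal.toReal_ofReal ha0]

lemma GeomLaw.integral_id {p : ℝ} {m : Measure ℕ} (h : GeomLaw p m) (hp : 0 < p)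
    (hp1 : p < 1) : Integrable (fun n : ℕ => (n : ℝ)) m ∧ ∫ n, (n : ℝ) ∂m = 1 / p := by
  refine h.integrable_and_integral hp.le hp1.le (fun n => Nat.cast_nonneg n) ?_
  have hq : ‖1 - p‖ < 1 := by rw [Real.norm_eq_abs, abs_lt]; constructor <;> linarith
  have h1 := (hasSum_choose_mul_geometric_of_norm_lt_one 1 hq).mul_right p
  rw [show 1 / p = 1 / (1 - (1 - p)) ^ (1 + 1) * p by rw [sub_sub_cancel]; field_simp]
  refine Eq.mpr (congrArg (fun f => HasSum f _) (funext fun n => ?_)) h1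
  rw [Nat.choose_one_right]; ring

lemma GeomLaw.integral_sq {p : ℝ} {m : Measure ℕ} (h : GeomLaw p m) (hp : 0 < p)
    (hp1 : p < 1) :
    Integrable (fun n : ℕ => (n : ℝ) ^ 2) m ∧ ∫ n, (n : ℝ) ^ 2 ∂m = (2 - p) / p ^ 2 := by
  refine h.integrable_and_integral hp.le hp1.le (fun n => by positivity) ?_
  have hq : ‖1 - p‖ < 1 := by rw [Real.norm_eq_abs, abs_lt]; constructor <;> linarith
  have h1 := (hasSum_choose_mul_geometric_of_norm_lt_one 1 hq).mul_right p
  -- The second moment comes from `(n + 1)² = 2 C(n + 2, 2) - C(n + 1, 1)`.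
  have h2 := (hasSum_choose_mul_geometric_of_norm_lt_one 2 hq).mul_right (2 * p)
  rw [show (2 - p) / p ^ 2 = 1 / (1 - (1 - p)) ^ (2 + 1) * (2 * p)
    - 1 / (1 - (1 - p)) ^ (1 + 1) * p by rw [sub_sub_cancel]; field_simp; ring]
  refine Eq.mpr (congrArg (fun f => HasSum f _) (funext fun n => ?_)) (h2.sub h1)
  rw [Nat.choose_one_right, Nat.cast_choose_two]; push_cast; ring

lemma GeomLaw.integral_exp {p : ℝ} {m : Measure ℕ} (h : GeomLaw p m) (hp : 0 < p)
    (hp1 : p < 1) {s : ℝ} (hs : 0 < 1 - (1 - p) * Real.exp s) :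
    Integrable (fun n : ℕ => Real.exp (s * n)) m ∧
      ∫ n, Real.exp (s * n) ∂m = p * Real.exp s / (1 - (1 - p) * Real.exp s) := by
  refine h.integrable_and_integral hp.le hp1.le (fun n => by positivity) ?_
  have hq : |(1 - p) * Real.exp s| < 1 := by
    rw [abs_of_nonneg (mul_nonneg (by linarith) (Real.exp_pos s).le)]; linarith
  have h1 := (hasSum_geometric_of_abs_lt_one hq).mul_right (p * Real.exp s)
  rw [div_eq_inv_mul]
  refine Eq.mpr (congrArg (fun f => HasSum f _) (funext fun n => ?_)) h1
  rw [mul_pow, ← Real.exp_nat_mul]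
  push_cast
  rw [mul_add, Real.exp_add, mul_one, mul_comm s]; ring

lemma GeomLaw.isProbabilityMeasure {p : ℝ} {m : Measure ℕ} (h : GeomLaw p m) (hp : 0 < p)
    (hp1 : p < 1) : IsProbabilityMeasure m := by
  constructor
  have := h.lintegral_ofReal hp.le hp1.le (f := fun _ => 1) (a := 1) (fun _ => zero_le_one) ?_
  · simpa using this
  · have h1 := (hasSum_geometric_of_lt_one (r := 1 - p) (by linarith) (by linarith)).mul_right p
    rw [sub_sub_cancel, inv_mul_cancel₀ hp.ne'] at h1
    exact Eq.mpr (congrArg (fun f => HasSum f _) (funext fun n => one_mul _)) h1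

lemma GeomLaw.ext {p : ℝ} {m m' : Measure ℕ} (h : GeomLaw p m) (h' : GeomLaw p m') : m = m' := by
  refine Measure.ext_of_singleton fun n => ?_
  cases n with
  | zero => rw [h.zero, h'.zero]
  | succ n => rw [h.succ, h'.succ]

lemma GeomLaw.ae_pos {p : ℝ} {m : Measure ℕ} (h : GeomLaw p m) : ∀ᵐ n ∂m, 1 ≤ n := by
  rw [ae_iff]
  convert h.zero using 2
  ext n; simp

/-- The distribution function of the geometric law. -/
lemma GeomLaw.measure_le {p : ℝ} {m : Measure ℕ} (h : GeomLaw p m) (hp : 0 < p)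
    (hp1 : p < 1) (n : ℕ) : m {j | j ≤ n} = ENNReal.ofReal (1 - (1 - p) ^ n) := by
  induction n with
  | zero => simp [h.zero]
  | succ n ih =>
    have : {j | j ≤ n + 1} = {j | j ≤ n} ∪ {n + 1} := by ext j; simp; omega
    rw [this, measure_union (by simp) (by measurability), ih, h.succ, ← ENNReal.ofReal_add]
    · congr 1; ring
    · have := pow_le_one₀ (n := n) (by linarith : 0 ≤ 1 - p) (by linarith); linarith
    · have : 0 ≤ 1 - p := by linarith
      positivity

/-- The prescribed masses on `{1, 2, …}` already sum to one, which leaves none for `0`. -/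
lemma isGeometric_geomLaw {Ω : Type*} [MeasurableSpace Ω] {P : Measure Ω} [IsProbabilityMeasure P]
    {p : ℝ} (hp : 0 < p) (hp1 : p < 1) {Y : Ω → ℕ} (hY : Measurable Y)
    (h : IsGeometric P p Y) : GeomLaw p (P.map Y) := by
  have hs : ∀ n : ℕ, P.map Y {n + 1} = ENNReal.ofReal ((1 - p) ^ n * p) := fun n => by
    rw [Measure.map_apply hY (measurableSet_singleton _), ← h n]; rfl
  refine ⟨?_, hs⟩
  have : IsProbabilityMeasure (P.map Y) := Measure.isProbabilityMeasure_map hY.aemeasurable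
  have h1 : ∑' n, P.map Y {n} = 1 := by
    have := lintegral_countable' (μ := P.map Y) (fun _ => (1 : ENNReal))
    simpa using this.symm
  rw [tsum_eq_zero_add' ENNReal.summable] at h1
  have h2 : ∑' n : ℕ, P.map Y {n + 1} = 1 := by
    simp_rw [hs]
    rw [← ENNReal.ofReal_tsum_of_nonneg]
    · rw [tsum_mul_right, tsum_geometric_of_lt_one (by linarith) (by linarith)]
      rw [sub_sub_cancel, inv_mul_cancel₀ hp.ne', ENNReal.ofReal_one]
    · intro n
      have : 0 ≤ 1 - p := by linarith
      positivity
    · exact (summable_geometric_of_lt_one (by linarith) (by linarith)).mul_right _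
  rw [h2] at h1
  have h3 : P.map Y {0} + 1 = 0 + 1 := by rw [h1, zero_add]
  exact (ENNReal.add_left_inj ENNReal.one_ne_top).1 h3

/-! ### The weighted norm of the age vector -/

/-- The weighted Euclidean norm of an age vector. -/
noncomputable def ageNorm {K : ℕ} (c : Fin K → ℝ) (z : Fin K → ℕ) : ℝ :=
  Real.sqrt (∑ k, c k * (z k : ℝ) ^ 2)

lemma ageNorm_nonneg {K : ℕ} (c : Fin K → ℝ) (z : Fin K → ℕ) : 0 ≤ ageNorm c z :=
  Real.sqrt_nonneg _

lemma ageNorm_sq {K : ℕ} {c : Fin K → ℝ} (hc : ∀ k, 0 ≤ c k) (z : Fin K → ℕ) :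
    ageNorm c z ^ 2 = ∑ k, c k * (z k : ℝ) ^ 2 :=
  Real.sq_sqrt (Finset.sum_nonneg fun k _ => mul_nonneg (hc k) (sq_nonneg _))

lemma ageNorm_mono {K : ℕ} {c : Fin K → ℝ} (hc : ∀ k, 0 ≤ c k) {z v : Fin K → ℕ} (h : z ≤ v) :
    ageNorm c z ≤ ageNorm c v := by
  refine Real.sqrt_le_sqrt (Finset.sum_le_sum fun k _ => mul_le_mul_of_nonneg_left ?_ (hc k))
  have : (z k : ℝ) ≤ v k := by exact_mod_cast h k
  gcongr

lemma sqrt_mul_le_ageNorm {K : ℕ} {c : Fin K → ℝ} (hc : ∀ k, 0 ≤ c k) (z : Fin K → ℕ)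
    (k : Fin K) : Real.sqrt (c k) * z k ≤ ageNorm c z := by
  refine Real.le_sqrt_of_sq_le ?_
  rw [mul_pow, Real.sq_sqrt (hc k)]
  exact Finset.single_le_sum (f := fun k => c k * (z k : ℝ) ^ 2)
    (fun k _ => mul_nonneg (hc k) (sq_nonneg _)) (Finset.mem_univ k)

lemma euclidean_norm_le_sum {K : ℕ} (v : EuclideanSpace ℝ (Fin K)) : ‖v‖ ≤ ∑ k, |v k| := by
  rw [EuclideanSpace.norm_eq]
  refine Real.sqrt_le_iff.2 ⟨Finset.sum_nonneg fun k _ => abs_nonneg _, ?_⟩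
  exact Finset.sum_sq_le_sq_sum_of_nonneg fun k _ => norm_nonneg _

/-- Reverse triangle inequality for the Euclidean norm of `(√c_k z_k)_k`, followed by `ℓ² ≤ ℓ¹` and
`c_k ≤ 1`. -/
lemma abs_ageNorm_sub_le {K : ℕ} {c : Fin K → ℝ} (hc : ∀ k, 0 ≤ c k) (hc1 : ∀ k, c k ≤ 1)
    (z v : Fin K → ℕ) : |ageNorm c v - ageNorm c z| ≤ ∑ k, |(v k : ℝ) - z k| := by
  let e : (Fin K → ℕ) → EuclideanSpace ℝ (Fin K) :=
    fun z => WithLp.toLp 2 fun k => Real.sqrt (c k) * z k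
  have he : ∀ z, ageNorm c z = ‖e z‖ := fun z => by
    rw [EuclideanSpace.norm_eq, ageNorm]
    congr 1
    refine Finset.sum_congr rfl fun k _ => ?_
    rw [Real.norm_eq_abs, sq_abs]
    simp [e, mul_pow, Real.sq_sqrt (hc k)]
  rw [he, he]
  refine (abs_norm_sub_norm_le _ _).trans ((euclidean_norm_le_sum _).trans ?_)
  refine Finset.sum_le_sum fun k _ => ?_
  have : (e v - e z) k = Real.sqrt (c k) * ((v k : ℝ) - z k) := by simp [e]; ring
  rw [this, abs_mul, abs_of_nonneg (Real.sqrt_nonneg _)]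
  have := Real.sqrt_le_one.2 (hc1 k)
  exact mul_le_of_le_one_left (abs_nonneg _) this

lemma ageNorm_le_sum {K : ℕ} {c : Fin K → ℝ} (hc : ∀ k, 0 ≤ c k) (hc1 : ∀ k, c k ≤ 1)
    (z : Fin K → ℕ) : ageNorm c z ≤ ∑ k, (z k : ℝ) := by
  have h := abs_ageNorm_sub_le hc hc1 (fun _ => 0) z
  have h0 : ageNorm c (fun _ => 0) = 0 := by simp [ageNorm]
  rw [h0, sub_zero, abs_of_nonneg (ageNorm_nonneg c z)] at h
  simpa using h

/-! ### One slot of the age process -/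

/-- The age in the next slot: it grows by one, and drops by the interarrival time `g` upon a
reward. -/
def nextAge {K : ℕ} (z : Fin K → ℕ) (R : Fin K → Bool) (g : Fin K → ℕ) (k : Fin K) : ℕ :=
  z k + 1 - (if R k = true then g k else 0)

/-- A gap is at least one, so it also dominates the growth by one in a slot without reward. -/
lemma abs_nextAge_sub_le {K : ℕ} (z : Fin K → ℕ) (R : Fin K → Bool) (g : Fin K → ℕ) (k : Fin K)
    (hg : 1 ≤ g k) : |(nextAge z R g k : ℝ) - z k| ≤ g k := by
  have h1 : nextAge z R g k ≤ z k + g k := by unfold nextAge; split_ifs <;> omega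
  have h2 : z k ≤ nextAge z R g k + g k := by unfold nextAge; split_ifs <;> omega
  have h1' : (nextAge z R g k : ℝ) ≤ z k + g k := by exact_mod_cast h1
  have h2' : (z k : ℝ) ≤ nextAge z R g k + g k := by exact_mod_cast h2
  rw [abs_le]; constructor <;> linarith

/-- The right side expands `(z + 1 - R g)²`, using `R² = R`. Truncation at zero can only decrease
the square. -/
lemma nextAge_sq_le {K : ℕ} (z : Fin K → ℕ) (R : Fin K → Bool) (g : Fin K → ℕ) (k : Fin K) :
    (nextAge z R g k : ℝ) ^ 2 ≤ (z k : ℝ) ^ 2 + (2 * z k + 1)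
      - (2 * z k + 2) * ((R k).toNat * g k) + (R k).toNat * (g k : ℝ) ^ 2 := by
  unfold nextAge
  cases R k
  · simp; nlinarith
  · simp only [if_true, Bool.toNat_true, Nat.cast_one, one_mul]
    rcases le_total (g k) (z k + 1) with h | h
    · rw [Nat.cast_sub h]; push_cast; nlinarith
    · rw [Nat.sub_eq_zero_of_le h]
      have : (0 : ℝ) ≤ (z k + 1 - g k) ^ 2 := sq_nonneg _
      push_cast; nlinarith

/-- Pointwise one-slot bound for the exponential of the age norm. -/
lemma exp_ageNorm_nextAge_le {K : ℕ} {c x : Fin K → ℝ} (hc : ∀ k, 0 ≤ c k)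
    (hc1 : ∀ k, c k ≤ 1) (hx : ∀ k, 0 < x k) (hx1 : ∀ k, x k ≤ 1) {r θ : ℝ} (hr : 0 ≤ r)
    (hθ : 0 < θ) (hrθ : r ≤ θ) (z : Fin K → ℕ) (hz : 0 < ageNorm c z) (R : Fin K → Bool)
    (g : Fin K → ℕ) (hg : ∀ k, 1 ≤ g k) :
    Real.exp (r * ageNorm c (nextAge z R g)) ≤ Real.exp (r * ageNorm c z) *
      (1 + r / (2 * ageNorm c z) * (∑ k, c k * ((2 * z k + 1)
        - (2 * z k + 2) * ((R k).toNat * g k) + (R k).toNat * (g k : ℝ) ^ 2))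
        + 2 * (r / θ) ^ 2 * Real.exp (∑ k, 2 * θ / x k * g k)) := by
  set φ := ageNorm c z
  set φ' := ageNorm c (nextAge z R g)
  have h1 : Real.exp (r * φ') = Real.exp (r * φ) * Real.exp (r * (φ' - φ)) := by
    rw [← Real.exp_add]; ring_nf
  rw [h1]
  refine mul_le_mul_of_nonneg_left ?_ (Real.exp_pos _).le
  -- Dividing by `x k ≤ 1` only weakens the bound; it produces the exponents `2 θ / x k` of `g(χ,
  -- θ)`.
  have hδ : |φ' - φ| ≤ ∑ k, (g k : ℝ) / x k := by
    refine (abs_ageNorm_sub_le hc hc1 _ _).trans (Finset.sum_le_sum fun k _ => ?_)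
    refine (abs_nextAge_sub_le z R g k (hg k)).trans ?_
    rw [le_div_iff₀ (hx k)]
    exact mul_le_of_le_one_right (Nat.cast_nonneg _) (hx1 k)
  refine (exp_mul_le_of_abs_le hr hθ hrθ hδ).trans ?_
  have h2 : 2 * θ * ∑ k, (g k : ℝ) / x k = ∑ k, 2 * θ / x k * g k := by
    rw [Finset.mul_sum]; exact Finset.sum_congr rfl fun k _ => by ring
  rw [h2]
  have h3 : φ' ^ 2 - φ ^ 2 ≤ ∑ k, c k * ((2 * z k + 1)
        - (2 * z k + 2) * ((R k).toNat * g k) + (R k).toNat * (g k : ℝ) ^ 2) := by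
    rw [ageNorm_sq hc, ageNorm_sq hc, ← Finset.sum_sub_distrib]
    refine Finset.sum_le_sum fun k _ => ?_
    rw [← mul_sub]
    refine mul_le_mul_of_nonneg_left ?_ (hc k)
    linarith [nextAge_sq_le z R g k]
  -- Concavity of the square root turns drift of `φ²` into drift of `φ`.
  have h4 : φ' - φ ≤ (φ' ^ 2 - φ ^ 2) / (2 * φ) := by
    rw [le_div_iff₀ (by positivity)]; nlinarith [sq_nonneg (φ' - φ)]
  have h5 : r * (φ' - φ) ≤ r / (2 * φ) * (∑ k, c k * ((2 * z k + 1)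
        - (2 * z k + 2) * ((R k).toNat * g k) + (R k).toNat * (g k : ℝ) ^ 2)) := by
    calc r * (φ' - φ) ≤ r * ((φ' ^ 2 - φ ^ 2) / (2 * φ)) := by gcongr
      _ = r / (2 * φ) * (φ' ^ 2 - φ ^ 2) := by ring
      _ ≤ _ := by gcongr
  linarith

/-- Crude one-slot bound for the exponential of the age norm. -/
lemma exp_ageNorm_nextAge_le_mul {K : ℕ} {c x : Fin K → ℝ} (hc : ∀ k, 0 ≤ c k)
    (hc1 : ∀ k, c k ≤ 1) (hx : ∀ k, 0 < x k) (hx1 : ∀ k, x k ≤ 1) {r θ : ℝ} (hr : 0 ≤ r)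
    (hrθ : r ≤ θ) (z : Fin K → ℕ) (R : Fin K → Bool)
    (g : Fin K → ℕ) (hg : ∀ k, 1 ≤ g k) :
    Real.exp (r * ageNorm c (nextAge z R g)) ≤
      Real.exp (r * ageNorm c z) * Real.exp (∑ k, 2 * θ / x k * g k) := by
  rw [← Real.exp_add]
  refine Real.exp_le_exp.2 ?_
  have h1 : ageNorm c (nextAge z R g) ≤ ageNorm c z + ∑ k, (g k : ℝ) := by
    have := (le_abs_self _).trans (abs_ageNorm_sub_le hc hc1 z (nextAge z R g))
    have h2 : ∑ k, |(nextAge z R g k : ℝ) - z k| ≤ ∑ k, (g k : ℝ) :=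
      Finset.sum_le_sum fun k _ => abs_nextAge_sub_le z R g k (hg k)
    linarith
  have h2 : r * ∑ k, (g k : ℝ) ≤ ∑ k, 2 * θ / x k * g k := by
    rw [Finset.mul_sum]
    refine Finset.sum_le_sum fun k _ => ?_
    gcongr
    rw [le_div_iff₀ (hx k)]
    nlinarith [hx k, hx1 k]
  nlinarith [mul_le_mul_of_nonneg_left h1 hr]

/-! ### Mean drift and exponential moments in one slot -/

section Slot

variable {K : ℕ} {St : Type*} [MeasurableSpace St] {X : St → Fin K → Bool} {ν : Measure St}
  {m : Fin K → Measure ℕ} {p : Fin K → ℝ}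

lemma toNat_and (a b : Bool) : (((a && b).toNat : ℕ) : ℝ) = (a.toNat : ℝ) * (b.toNat : ℝ) := by
  cases a <;> cases b <;> simp

lemma toNat_mem (b : Bool) : (b.toNat : ℝ) = 0 ∨ (b.toNat : ℝ) = 1 := by cases b <;> simp

lemma toNat_le_one (b : Bool) : (b.toNat : ℝ) ≤ 1 := by cases b <;> simp

lemma measurable_channel (hX : ∀ k, Measurable (fun s => X s k)) (k : Fin K) :
    Measurable (fun s => ((X s k).toNat : ℝ)) :=
  (measurable_of_countable (fun b : Bool => (b.toNat : ℝ))).comp (hX k)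

lemma integrable_channel [IsProbabilityMeasure ν] (hX : ∀ k, Measurable (fun s => X s k))
    (k : Fin K) : Integrable (fun s => ((X s k).toNat : ℝ)) ν :=
  Integrable.of_bound (measurable_channel hX k).aestronglyMeasurable 1
    (ae_of_all _ fun s => by cases X s k <;> simp)

lemma channelRate_nonneg (ν : Measure St) (X : St → Fin K → Bool) (k : Fin K) :
    0 ≤ channelRate ν X k := integral_nonneg fun _ => Nat.cast_nonneg _

lemma channelRate_le_one [IsProbabilityMeasure ν] (hX : ∀ k, Measurable (fun s => X s k))
    (k : Fin K) : channelRate ν X k ≤ 1 := by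
  refine (integral_mono (integrable_channel hX k) (integrable_const 1)
    fun s => toNat_le_one (X s k)).trans ?_
  simp

lemma integral_channel_mul [IsProbabilityMeasure ν] [∀ k, IsProbabilityMeasure (m k)]
    (hX : ∀ k, Measurable (fun s => X s k)) (k : Fin K) {f : ℕ → ℝ} (hf : Integrable f (m k)) :
    Integrable (fun q : St × (Fin K → ℕ) => ((X q.1 k).toNat : ℝ) * f (q.2 k))
      (ν.prod (Measure.pi m)) ∧
    ∫ q, ((X q.1 k).toNat : ℝ) * f (q.2 k) ∂(ν.prod (Measure.pi m))
      = channelRate ν X k * ∫ n, f n ∂m k := by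
  refine ⟨(integrable_channel hX k).mul_prod (integrable_comp_eval (i := k) hf), ?_⟩
  rw [integral_prod_mul (fun s => ((X s k).toNat : ℝ)) (fun g : Fin K → ℕ => f (g k)),
    integral_comp_eval (i := k) hf.aestronglyMeasurable]
  rfl

lemma integral_exp_gaps [IsProbabilityMeasure ν] [∀ k, IsProbabilityMeasure (m k)]
    (hm : ∀ k, GeomLaw (p k) (m k)) (hp : ∀ k, 0 < p k) (hp1 : ∀ k, p k < 1) {s : Fin K → ℝ}
    (hs : ∀ k, 0 < 1 - (1 - p k) * Real.exp (s k)) :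
    Integrable (fun q : St × (Fin K → ℕ) => Real.exp (∑ k, s k * q.2 k))
      (ν.prod (Measure.pi m)) ∧
    ∫ q : St × (Fin K → ℕ), Real.exp (∑ k, s k * q.2 k) ∂(ν.prod (Measure.pi m))
      = ∏ k, p k * Real.exp (s k) / (1 - (1 - p k) * Real.exp (s k)) := by
  simp_rw [Real.exp_sum]
  have hi : Integrable (fun g : Fin K → ℕ => ∏ k, Real.exp (s k * g k)) (Measure.pi m) :=
    Integrable.fintype_prod (f := fun k (n : ℕ) => Real.exp (s k * n))
      fun k => ((hm k).integral_exp (hp k) (hp1 k) (hs k)).1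
  refine ⟨hi.comp_snd ν, ?_⟩
  rw [integral_fun_snd (fun g : Fin K → ℕ => ∏ k, Real.exp (s k * g k)),
    integral_fintype_prod_eq_prod (fun k (n : ℕ) => Real.exp (s k * n))]
  rw [probReal_univ, one_smul]
  exact Finset.prod_congr rfl fun k _ => ((hm k).integral_exp (hp k) (hp1 k) (hs k)).2

lemma ae_gaps_pos [IsProbabilityMeasure ν] [∀ k, IsProbabilityMeasure (m k)]
    (hm : ∀ k, GeomLaw (p k) (m k)) :
    ∀ᵐ q : St × (Fin K → ℕ) ∂(ν.prod (Measure.pi m)), ∀ k, 1 ≤ q.2 k := by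
  rw [ae_all_iff]
  intro k
  have h1 : Measure.QuasiMeasurePreserving (fun q : St × (Fin K → ℕ) => q.2 k)
      (ν.prod (Measure.pi m)) (m k) :=
    (measurePreserving_eval m k).quasiMeasurePreserving.comp Measure.quasiMeasurePreserving_snd
  exact h1.ae (hm k).ae_pos

/-- The moment generating function of a geometric variable decreases in its parameter. Replacing
`χ_k + ε` by `χ_k` makes the window constant independent of `ε`. -/
lemma mgf_le_mgf_of_le {p y s : ℝ} (hyp : y ≤ p) (hs : 0 ≤ s)
    (h : 0 < 1 - (1 - y) * Real.exp s) :
    0 < 1 - (1 - p) * Real.exp s ∧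
    p * Real.exp s / (1 - (1 - p) * Real.exp s) ≤
      y * Real.exp s / (1 - (1 - y) * Real.exp s) := by
  have he := Real.one_le_exp hs
  have h1 : 0 < 1 - (1 - p) * Real.exp s := by nlinarith
  refine ⟨h1, ?_⟩
  rw [div_le_div_iff₀ h1 h]
  nlinarith [mul_nonneg (mul_nonneg (sub_nonneg.2 hyp) (sub_nonneg.2 he)) (Real.exp_pos s).le]

/-- The exponential moment of the gaps of one slot is at most `g(χ, θ)`. -/
lemma integral_exp_gaps_le [IsProbabilityMeasure ν] [∀ k, IsProbabilityMeasure (m k)]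
    (hm : ∀ k, GeomLaw (p k) (m k)) {χ x : Fin K → ℝ} (hχ : ∀ k, 0 < χ k)
    (hχp : ∀ k, χ k ≤ p k) (hp1 : ∀ k, p k < 1) (hx : ∀ k, 0 < x k) {θ : ℝ} (hθ : 0 < θ)
    (hs : ∀ k, 0 < 1 - (1 - χ k) * Real.exp (2 * θ / x k)) :
    Integrable (fun q : St × (Fin K → ℕ) => Real.exp (∑ k, 2 * θ / x k * q.2 k))
      (ν.prod (Measure.pi m)) ∧
    ∫ q : St × (Fin K → ℕ), Real.exp (∑ k, 2 * θ / x k * q.2 k) ∂(ν.prod (Measure.pi m))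
      ≤ mgfProd x χ θ := by
  have h0 : ∀ k, 0 ≤ 2 * θ / x k := fun k => by have := hx k; positivity
  have h1 := fun k => mgf_le_mgf_of_le (hχp k) (h0 k) (hs k)
  have hp : ∀ k, 0 < p k := fun k => (hχ k).trans_le (hχp k)
  have h2 := integral_exp_gaps (ν := ν) hm hp hp1 fun k => (h1 k).1
  refine ⟨h2.1, h2.2.trans_le ?_⟩
  refine Finset.prod_le_prod (fun k _ => ?_) fun k _ => (h1 k).2
  have := (h1 k).1
  have := hp k
  positivity

/-- A lower bound on `g(χ, θ)`. -/
lemma exp_le_mgfProd {χ x : Fin K → ℝ} (hK : 0 < K) (hχ1 : ∀ k, χ k ≤ 1)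
    (hx : ∀ k, 0 < x k) (hx1 : ∀ k, x k ≤ 1) {θ : ℝ} (hθ : 0 < θ)
    (hs : ∀ k, 0 < 1 - (1 - χ k) * Real.exp (2 * θ / x k)) :
    Real.exp (2 * θ) ≤ mgfProd x χ θ := by
  have hf : ∀ k, Real.exp (2 * θ) ≤
      χ k * Real.exp (2 * θ / x k) / (1 - (1 - χ k) * Real.exp (2 * θ / x k)) := fun k => by
    rw [le_div_iff₀ (hs k)]
    have h0 : 2 * θ ≤ 2 * θ / x k := by
      rw [le_div_iff₀ (hx k)]; nlinarith [hx1 k]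
    have h1 := Real.exp_le_exp.2 h0
    have h2 : 1 ≤ Real.exp (2 * θ / x k) := Real.one_le_exp (by have := hx k; positivity)
    have h3 : 1 - (1 - χ k) * Real.exp (2 * θ / x k) ≤ χ k := by nlinarith [hχ1 k]
    rw [mul_comm]
    exact mul_le_mul h3 h1 (Real.exp_pos _).le ((hs k).le.trans h3)
  calc Real.exp (2 * θ) ≤ Real.exp (2 * θ) ^ K :=
        le_self_pow₀ (Real.one_le_exp (by positivity)) hK.ne'
    _ = ∏ _k : Fin K, Real.exp (2 * θ) := by simp
    _ ≤ _ := Finset.prod_le_prod (fun k _ => (Real.exp_pos _).le) fun k _ => hf k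

/-- The channel and the gap are independent, so only the first two geometric moments, `1 / p` and
`(2 - p) / p²`, enter. -/
lemma integral_drift [IsProbabilityMeasure ν] [∀ k, IsProbabilityMeasure (m k)]
    (hX : ∀ k, Measurable (fun s => X s k)) (hm : ∀ k, GeomLaw (p k) (m k)) (hp : ∀ k, 0 < p k)
    (hp1 : ∀ k, p k < 1) (c : Fin K → ℝ) (z : Fin K → ℕ) (i : Fin K → Bool) :
    Integrable (fun q : St × (Fin K → ℕ) => ∑ k, c k * ((2 * z k + 1)
        - (2 * z k + 2) * ((X q.1 k && i k).toNat * q.2 k)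
        + (X q.1 k && i k).toNat * (q.2 k : ℝ) ^ 2)) (ν.prod (Measure.pi m)) ∧
    ∫ q : St × (Fin K → ℕ), ∑ k, c k * ((2 * z k + 1)
        - (2 * z k + 2) * ((X q.1 k && i k).toNat * q.2 k)
        + (X q.1 k && i k).toNat * (q.2 k : ℝ) ^ 2) ∂(ν.prod (Measure.pi m))
      = ∑ k, c k * ((2 * z k + 1) - (2 * z k + 2) * ((i k).toNat * (channelRate ν X k / p k))
        + (i k).toNat * (channelRate ν X k * ((2 - p k) / p k ^ 2))) := by
  have e : (fun q : St × (Fin K → ℕ) => ∑ k, c k * ((2 * z k + 1)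
        - (2 * z k + 2) * ((X q.1 k && i k).toNat * q.2 k)
        + (X q.1 k && i k).toNat * (q.2 k : ℝ) ^ 2)) =
      fun q => ∑ k, c k * (((2 * z k + 1)
        - (2 * z k + 2) * (i k).toNat * ((X q.1 k).toNat * (q.2 k : ℝ)))
        + (i k).toNat * ((X q.1 k).toNat * (q.2 k : ℝ) ^ 2)) := by
    funext q
    refine Finset.sum_congr rfl fun k _ => ?_
    rw [toNat_and]; ring
  have h1 := fun k => integral_channel_mul (ν := ν) hX k ((hm k).integral_id (hp k) (hp1 k)).1
  have h2 := fun k => integral_channel_mul (ν := ν) hX k ((hm k).integral_sq (hp k) (hp1 k)).1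
  have i1 := fun k => (integrable_const (μ := ν.prod (Measure.pi m)) (2 * (z k : ℝ) + 1)).sub
    ((h1 k).1.const_mul ((2 * z k + 2) * (i k).toNat))
  have i2 := fun k => (h2 k).1.const_mul ((i k).toNat : ℝ)
  have i3 := fun k => ((i1 k).add (i2 k)).const_mul (c k)
  rw [e]
  refine ⟨integrable_finsetSum _ fun k _ => i3 k, ?_⟩
  refine (integral_finsetSum _ fun k _ => i3 k).trans ?_
  refine Finset.sum_congr rfl fun k _ => ?_
  rw [integral_const_mul]
  congr 1
  have e1 := integral_add (i1 k) (i2 k)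
  have e2 := integral_sub (integrable_const (μ := ν.prod (Measure.pi m)) (2 * (z k : ℝ) + 1))
    ((h1 k).1.const_mul ((2 * z k + 2) * (i k).toNat))
  simp only [Pi.sub_apply, Pi.add_apply] at e1 e2 ⊢
  rw [e1, e2, integral_const_mul, integral_const_mul, (h1 k).2, (h2 k).2,
    ((hm k).integral_id (hp k) (hp1 k)).2, ((hm k).integral_sq (hp k) (hp1 k)).2]
  simp
  ring

/-- The weight `p / x` cancels the mean decrease `x / p` of a scheduled arm, which leaves the term
`z j` that the policy maximizes. The rest is `p / x + j (2 / p - 3) ≤ 2 / (p x)`. -/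
lemma drift_term_le {χ p x j z : ℝ} (hχ : 0 < χ) (hχp : χ ≤ p) (hpx : p ≤ x) (hx1 : x ≤ 1)
    (hj : j = 0 ∨ j = 1) :
    p / x * ((2 * z + 1) - (2 * z + 2) * (j * (x / p)) + j * (x * ((2 - p) / p ^ 2)))
      ≤ 2 * z * (p / x - j) + 2 * (1 / (χ * x)) := by
  have hp : 0 < p := hχ.trans_le hχp
  have hx : 0 < x := hp.trans_le hpx
  have h1 : 1 / (p * x) ≤ 1 / (χ * x) := by gcongr
  have h2 : p / x * ((2 * z + 1) - (2 * z + 2) * (j * (x / p)) + j * (x * ((2 - p) / p ^ 2)))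
      = 2 * z * (p / x - j) + (p / x + j * (2 / p - 3)) := by field_simp; ring
  have h3 : p / x + j * (2 / p - 3) ≤ 2 * (1 / (p * x)) := by
    have e : p / x + j * (2 / p - 3) = (p ^ 2 + j * (2 * x - 3 * (p * x))) / (p * x) := by
      field_simp
    rw [e, mul_one_div]
    gcongr
    rcases hj with rfl | rfl <;> nlinarith
  linarith

/-- One slot of the policy contracts the exponential of the age norm while the norm is large. -/
lemma lintegral_exp_ageNorm_nextAge_le [IsProbabilityMeasure ν]
    [∀ k, IsProbabilityMeasure (m k)]
    (hX : ∀ k, Measurable (fun s => X s k)) (hm : ∀ k, GeomLaw (p k) (m k))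
    {χ : Fin K → ℝ} {γ η θ : ℝ} (hγ : 0 < γ) (hχ : ∀ k, 0 < χ k) (hχp : ∀ k, χ k ≤ p k)
    (hpx : ∀ k, p k + γ / 2 ≤ channelRate ν X k) (hθ : 0 < θ)
    (hs : ∀ k, 0 < 1 - (1 - χ k) * Real.exp (2 * θ / channelRate ν X k))
    {z : Fin K → ℕ} {i : Fin K → Bool}
    (hmax : ∑ k, (z k : ℝ) * ((p k + γ / 2) / channelRate ν X k)
      ≤ ∑ k, (z k : ℝ) * (i k).toNat + K * η)
    (hz : 0 < ageNorm (fun k => p k / channelRate ν X k) z)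
    (hA : 4 / γ * (K * η + ∑ k, 1 / (χ k * channelRate ν X k))
      ≤ ageNorm (fun k => p k / channelRate ν X k) z)
    {r : ℝ} (hr : 0 ≤ r) (hrθ : r ≤ θ) :
    ∫⁻ q : St × (Fin K → ℕ), ENNReal.ofReal (Real.exp (r *
        ageNorm (fun k => p k / channelRate ν X k) (nextAge z (fun k => X q.1 k && i k) q.2)))
        ∂(ν.prod (Measure.pi m))
      ≤ ENNReal.ofReal ((1 - r * (γ / 4) +
          2 * (r / θ) ^ 2 * mgfProd (channelRate ν X) χ θ)
        * Real.exp (r * ageNorm (fun k => p k / channelRate ν X k) z)) := by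
  set x := channelRate ν X
  set c : Fin K → ℝ := fun k => p k / x k
  set φ := ageNorm c z
  have hp : ∀ k, 0 < p k := fun k => (hχ k).trans_le (hχp k)
  have hpx' : ∀ k, p k < x k := fun k => by have := hpx k; linarith
  have hx : ∀ k, 0 < x k := fun k => (hp k).trans (hpx' k)
  have hx1 : ∀ k, x k ≤ 1 := fun k => channelRate_le_one hX k
  have hp1 : ∀ k, p k < 1 := fun k => (hpx' k).trans_le (hx1 k)
  have hc : ∀ k, 0 ≤ c k := fun k => (div_pos (hp k) (hx k)).le
  have hc1 : ∀ k, c k ≤ 1 := fun k => (div_le_one (hx k)).2 (hpx' k).le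
  obtain ⟨hi1, he1⟩ := integral_drift (ν := ν) hX hm hp hp1 c z i
  obtain ⟨hi2, he2⟩ := integral_exp_gaps_le (ν := ν) hm hχ hχp hp1 hx hθ hs
  set μ := ν.prod (Measure.pi m)
  set D : St × (Fin K → ℕ) → ℝ := fun q => ∑ k, c k * ((2 * z k + 1)
        - (2 * z k + 2) * ((X q.1 k && i k).toNat * q.2 k)
        + (X q.1 k && i k).toNat * (q.2 k : ℝ) ^ 2)
  set E : St × (Fin K → ℕ) → ℝ := fun q => Real.exp (∑ k, 2 * θ / x k * q.2 k)
  -- The slack `γ / 2` in `hmax` leaves `-γ ∑ z_k / x_k`, which is at most `-γ φ` because `φ ≤ ∑ z_k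
  -- ≤ ∑ z_k / x_k`.
  have hD : ∫ q, D q ∂μ ≤ -γ * φ + 2 * (K * η + ∑ k, 1 / (χ k * x k)) := by
    rw [he1]
    have h1 : ∑ k, c k * ((2 * z k + 1) - (2 * z k + 2) * ((i k).toNat * (x k / p k))
        + (i k).toNat * (x k * ((2 - p k) / p k ^ 2))) ≤
        ∑ k, (2 * z k * (p k / x k - (i k).toNat) + 2 * (1 / (χ k * x k))) :=
      Finset.sum_le_sum fun k _ =>
        drift_term_le (hχ k) (hχp k) (hpx' k).le (hx1 k) (toNat_mem _)
    have h2 : ∑ k, (2 * z k * (p k / x k - (i k).toNat) + 2 * (1 / (χ k * x k))) =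
        2 * ∑ k, (z k : ℝ) * ((p k + γ / 2) / x k) - 2 * ∑ k, (z k : ℝ) * (i k).toNat
        - γ * ∑ k, (z k : ℝ) / x k + 2 * ∑ k, 1 / (χ k * x k) := by
      simp only [Finset.mul_sum, ← Finset.sum_sub_distrib, ← Finset.sum_add_distrib]
      exact Finset.sum_congr rfl fun k _ => by have := hx k; field_simp; ring
    have h3 : φ ≤ ∑ k, (z k : ℝ) / x k := by
      refine (ageNorm_le_sum hc hc1 z).trans (Finset.sum_le_sum fun k _ => ?_)
      rw [le_div_iff₀ (hx k)]
      exact mul_le_of_le_one_right (Nat.cast_nonneg _) (hx1 k)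
    have h4 := mul_le_mul_of_nonneg_left h3 hγ.le
    linarith
  set B : St × (Fin K → ℕ) → ℝ := fun q => Real.exp (r * φ) *
    (1 + r / (2 * φ) * D q + 2 * (r / θ) ^ 2 * E q)
  have hiB' : Integrable (fun q => 1 + r / (2 * φ) * D q) μ :=
    (integrable_const _).add (hi1.const_mul _)
  have hiB : Integrable B μ := (hiB'.add (hi2.const_mul _)).const_mul _
  have hB : ∫ q, B q ∂μ ≤ (1 - r * (γ / 4) + 2 * (r / θ) ^ 2 * mgfProd x χ θ)
      * Real.exp (r * φ) := by
    have e1 : ∫ q, B q ∂μ = Real.exp (r * φ) *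
        (1 + r / (2 * φ) * ∫ q, D q ∂μ + 2 * (r / θ) ^ 2 * ∫ q, E q ∂μ) := by
      simp only [B]
      rw [integral_const_mul, integral_add hiB' (hi2.const_mul _),
        integral_add (integrable_const _) (hi1.const_mul _), integral_const_mul,
        integral_const_mul]
      simp
    rw [e1, mul_comm]
    refine mul_le_mul_of_nonneg_right ?_ (Real.exp_pos _).le
    -- The threshold on `φ` lets half of `-γ φ` absorb the constant; dividing by `2 φ` leaves the
    -- drift `-γ / 4`.
    have h1 : r / (2 * φ) * ∫ q, D q ∂μ ≤ - (r * (γ / 4)) := by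
      have h2 : K * η + ∑ k, 1 / (χ k * x k) ≤ γ / 4 * φ := by
        rw [div_mul_eq_mul_div, div_le_iff₀ hγ] at hA; linarith
      have h3 : ∫ q, D q ∂μ ≤ - (γ / 2) * φ := by linarith
      calc r / (2 * φ) * ∫ q, D q ∂μ ≤ r / (2 * φ) * (- (γ / 2) * φ) := by gcongr
        _ = _ := by field_simp; ring
    have h2 : 2 * (r / θ) ^ 2 * ∫ q, E q ∂μ ≤ 2 * (r / θ) ^ 2 * mgfProd x χ θ := by gcongr
    linarith
  have hae : ∀ᵐ q ∂μ, Real.exp (r * ageNorm c (nextAge z (fun k => X q.1 k && i k) q.2)) ≤ B q := by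
    filter_upwards [ae_gaps_pos (ν := ν) hm] with q hq
    exact exp_ageNorm_nextAge_le hc hc1 hx hx1 hr hθ hrθ z hz _ _ hq
  calc _ ≤ ∫⁻ q, ENNReal.ofReal (B q) ∂μ :=
        lintegral_mono_ae (hae.mono fun q hq => ENNReal.ofReal_le_ofReal hq)
    _ = ENNReal.ofReal (∫ q, B q ∂μ) := (ofReal_integral_eq_lintegral_ofReal hiB
        (hae.mono fun q hq => (Real.exp_pos _).le.trans hq)).symm
    _ ≤ _ := ENNReal.ofReal_le_ofReal hB

/-- In one slot the exponential of the age norm grows at most by the factor `g(χ, θ)`. -/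
lemma lintegral_exp_ageNorm_nextAge_le_mgfProd [IsProbabilityMeasure ν]
    [∀ k, IsProbabilityMeasure (m k)]
    (hX : ∀ k, Measurable (fun s => X s k)) (hm : ∀ k, GeomLaw (p k) (m k))
    {χ : Fin K → ℝ} {θ : ℝ} (hχ : ∀ k, 0 < χ k) (hχp : ∀ k, χ k ≤ p k)
    (hpx : ∀ k, p k < channelRate ν X k) (hθ : 0 < θ)
    (hs : ∀ k, 0 < 1 - (1 - χ k) * Real.exp (2 * θ / channelRate ν X k))
    (z : Fin K → ℕ) (i : Fin K → Bool) {r : ℝ} (hr : 0 ≤ r) (hrθ : r ≤ θ) :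
    ∫⁻ q : St × (Fin K → ℕ), ENNReal.ofReal (Real.exp (r *
        ageNorm (fun k => p k / channelRate ν X k) (nextAge z (fun k => X q.1 k && i k) q.2)))
        ∂(ν.prod (Measure.pi m))
      ≤ ENNReal.ofReal (mgfProd (channelRate ν X) χ θ
        * Real.exp (r * ageNorm (fun k => p k / channelRate ν X k) z)) := by
  set x := channelRate ν X
  set c : Fin K → ℝ := fun k => p k / x k
  have hp : ∀ k, 0 < p k := fun k => (hχ k).trans_le (hχp k)
  have hx : ∀ k, 0 < x k := fun k => (hp k).trans (hpx k)
  have hx1 : ∀ k, x k ≤ 1 := fun k => channelRate_le_one hX k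
  have hp1 : ∀ k, p k < 1 := fun k => (hpx k).trans_le (hx1 k)
  have hc : ∀ k, 0 ≤ c k := fun k => (div_pos (hp k) (hx k)).le
  have hc1 : ∀ k, c k ≤ 1 := fun k => (div_le_one (hx k)).2 (hpx k).le
  obtain ⟨hi2, he2⟩ := integral_exp_gaps_le (ν := ν) hm hχ hχp hp1 hx hθ hs
  have hae : ∀ᵐ q ∂(ν.prod (Measure.pi m)),
      Real.exp (r * ageNorm c (nextAge z (fun k => X q.1 k && i k) q.2)) ≤
      Real.exp (r * ageNorm c z) * Real.exp (∑ k, 2 * θ / x k * q.2 k) := by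
    filter_upwards [ae_gaps_pos (ν := ν) hm] with q hq
    exact exp_ageNorm_nextAge_le_mul hc hc1 hx hx1 hr hrθ z _ _ hq
  calc _ ≤ _ := lintegral_mono_ae (hae.mono fun q hq => ENNReal.ofReal_le_ofReal hq)
    _ = _ := (ofReal_integral_eq_lintegral_ofReal (hi2.const_mul _)
        (ae_of_all _ fun q => by positivity)).symm
    _ ≤ _ := by
      refine ENNReal.ofReal_le_ofReal ?_
      rw [integral_const_mul, mul_comm]
      gcongr

end Slot

/-! ### Sample paths of one virtual queue -/

lemma arrivalTime_succ (G : ℕ → ℕ) (l : ℕ) : arrivalTime G (l + 1) = arrivalTime G l + G l :=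
  Finset.sum_range_succ _ _

lemma arrivalTime_congr {G G' : ℕ → ℕ} {l : ℕ} (h : ∀ j < l, G j = G' j) :
    arrivalTime G l = arrivalTime G' l :=
  Finset.sum_congr rfl fun j hj => h j (Finset.mem_range.1 hj)

lemma nextToDepart_succ (G : ℕ → ℕ) (r : ℕ → Bool) (t : ℕ) :
    nextToDepart G r (t + 1) =
      if 1 ≤ t ∧ r t = true ∧ arrivalTime G (nextToDepart G r t) ≤ t then nextToDepart G r t + 1
      else nextToDepart G r t := rfl

lemma nextToDepart_one (G : ℕ → ℕ) (r : ℕ → Bool) : nextToDepart G r 1 = 1 := by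
  simp [nextToDepart]

lemma nextToDepart_le_succ (G : ℕ → ℕ) (r : ℕ → Bool) (t : ℕ) :
    nextToDepart G r t ≤ nextToDepart G r (t + 1) := by
  rw [nextToDepart_succ]; split_ifs <;> omega

lemma nextToDepart_mono (G : ℕ → ℕ) (r : ℕ → Bool) : Monotone (nextToDepart G r) :=
  monotone_nat_of_le_succ (nextToDepart_le_succ G r)

lemma nextToDepart_le (G : ℕ → ℕ) (r : ℕ → Bool) {t : ℕ} (ht : 1 ≤ t) :
    nextToDepart G r t ≤ t := by
  induction t, ht using Nat.le_induction with
  | base => rw [nextToDepart_one]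
  | succ t _ ih => rw [nextToDepart_succ]; split_ifs <;> omega

/-- The queue position only depends on the rewards so far and on the gaps of departed requests. -/
lemma nextToDepart_congr {G G' : ℕ → ℕ} {r r' : ℕ → Bool} {t : ℕ}
    (hr : ∀ τ ∈ Finset.Ico 1 t, r τ = r' τ) (hG : ∀ j < nextToDepart G r t, G j = G' j) :
    nextToDepart G r t = nextToDepart G' r' t := by
  induction t with
  | zero => rfl
  | succ t ih =>
    have hle := nextToDepart_le_succ G r t
    have hG' : ∀ j < nextToDepart G r t, G j = G' j := fun j hj => hG j (hj.trans_le hle)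
    have e := ih (fun τ hτ => hr τ (by simp at hτ ⊢; omega)) hG'
    rw [nextToDepart_succ, nextToDepart_succ, ← e, ← arrivalTime_congr hG']
    rcases Nat.eq_zero_or_pos t with h0 | h0
    · simp [h0]
    · rw [hr t (by simp; omega)]

/-- The head-of-line age grows by at most one, less the gap upon a reward. -/
lemma headAge_succ_le (G : ℕ → ℕ) (r : ℕ → Bool) {t : ℕ} (ht : 1 ≤ t) :
    headAge G r (t + 1) ≤
      headAge G r t + 1 - (if r t = true then G (nextToDepart G r t) else 0) := by
  unfold headAge
  rw [nextToDepart_succ]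
  by_cases hr : r t = true
  · by_cases ha : arrivalTime G (nextToDepart G r t) ≤ t
    · rw [if_pos ⟨ht, hr, ha⟩, if_pos hr, arrivalTime_succ]; omega
    -- The request has not arrived by slot `t`, so its age at `t + 1` is zero whatever the reward.
    · rw [if_neg (fun h => ha h.2.2)]; omega
  · rw [if_neg (fun h => hr h.2.1), if_neg hr]; omega

lemma headAge_one_le (G : ℕ → ℕ) (r : ℕ → Bool) : headAge G r 1 = 1 - G 0 := by
  simp [headAge, nextToDepart_one, arrivalTime]

lemma le_headAge_add_arrivalTime (G : ℕ → ℕ) (r : ℕ → Bool) (t : ℕ) :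
    t ≤ headAge G r t + arrivalTime G (nextToDepart G r t) := by
  unfold headAge; omega

/-- Departures need rewards. -/
lemma nextToDepart_le_add_sum (G : ℕ → ℕ) (r : ℕ → Bool) {s t : ℕ} (h : s ≤ t + 1) :
    nextToDepart G r (t + 1) ≤ nextToDepart G r s + ∑ τ ∈ Finset.Icc s t, (r τ).toNat := by
  have key : ∀ n, nextToDepart G r (s + n) ≤
      nextToDepart G r s + ∑ τ ∈ Finset.Ico s (s + n), (r τ).toNat := fun n => by
    induction n with
    | zero => simp
    | succ n ih =>
      rw [← add_assoc, Finset.sum_Ico_succ_top (by omega), nextToDepart_succ]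
      split_ifs with hc
      · rw [hc.2.1]; simp only [Bool.toNat_true]; omega
      · omega
  have := key (t + 1 - s)
  rwa [Nat.add_sub_cancel' h] at this

/-- Requests depart after their arrival. -/
lemma arrivalTime_lt_of_lt_nextToDepart (G : ℕ → ℕ) (r : ℕ → Bool) {t l : ℕ} (ht : 1 ≤ t)
    (hl : l < nextToDepart G r t) : arrivalTime G l < t := by
  induction t, ht using Nat.le_induction with
  | base =>
    rw [nextToDepart_one] at hl
    obtain rfl : l = 0 := by omega
    simp [arrivalTime]
  | succ t _ ih =>
    rcases lt_or_ge l (nextToDepart G r t) with h | h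
    · exact (ih h).trans (Nat.lt_succ_self t)
    · rw [nextToDepart_succ] at hl
      split_ifs at hl with hc
      · obtain rfl : l = nextToDepart G r t := by omega
        omega
      · omega

/-- All requests before the current one have departed, hence arrived by slot `t - 1`. The cutoff `l
< t` loses nothing because at most one request departs per slot. -/
lemma nextToDepart_le_card (G : ℕ → ℕ) (r : ℕ → Bool) {t : ℕ} (ht : 1 ≤ t) :
    nextToDepart G r t ≤ 1 + ∑ l ∈ Finset.Ico 1 t, if arrivalTime G l ≤ t - 1 then 1 else 0 := by
  have h1 := nextToDepart_le G r ht
  have h2 : nextToDepart G r t - 1 = ∑ l ∈ Finset.Ico 1 (nextToDepart G r t), 1 := by simp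
  have h3 : ∑ l ∈ Finset.Ico 1 (nextToDepart G r t), 1 =
      ∑ l ∈ Finset.Ico 1 (nextToDepart G r t), if arrivalTime G l ≤ t - 1 then 1 else 0 := by
    refine Finset.sum_congr rfl fun l hl => ?_
    have := arrivalTime_lt_of_lt_nextToDepart G r ht (Finset.mem_Ico.1 hl).2
    rw [if_pos (by omega)]
  have h4 : ∑ l ∈ Finset.Ico 1 (nextToDepart G r t), (if arrivalTime G l ≤ t - 1 then 1 else 0)
      ≤ ∑ l ∈ Finset.Ico 1 t, if arrivalTime G l ≤ t - 1 then 1 else 0 :=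
    Finset.sum_le_sum_of_subset (Finset.Ico_subset_Ico_right h1)
  omega

/-! ### UCB estimates lie in `[0, 1]` -/

lemma meanEstimate_nonneg (i r : ℕ → Bool) (t : ℕ) : 0 ≤ meanEstimate i r t := by
  induction t with
  | zero => exact le_rfl
  | succ t ih => unfold meanEstimate; split_ifs <;> positivity

lemma ucb_nonneg (i r : ℕ → Bool) (t : ℕ) : 0 ≤ ucb i r t := by
  unfold ucb
  split_ifs
  · exact le_min zero_le_one (add_nonneg (meanEstimate_nonneg i r t) (Real.sqrt_nonneg _))
  · exact zero_le_one

lemma ucb_le_one (i r : ℕ → Bool) (t : ℕ) : ucb i r t ≤ 1 := by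
  unfold ucb
  split_ifs
  · exact min_le_left _ _
  · exact le_rfl

/-! ### Maximizing the score against the randomized stationary action -/

lemma tsum_pmf_mul_le {Act : Type*} (σ : PMF Act) {f : Act → ℝ} {b M : ℝ} (hf0 : ∀ a, 0 ≤ f a)
    (hf : ∀ a, f a ≤ M) (hb : M ≤ b) : ∑' a, (σ a).toReal * f a ≤ b := by
  have hs : Summable fun a => (σ a).toReal := ENNReal.summable_toReal σ.tsum_coe_ne_top
  have h1 : ∑' a, (σ a).toReal = 1 := by
    rw [← ENNReal.tsum_toReal_eq (fun a => σ.apply_ne_top a), σ.tsum_coe, ENNReal.toReal_one]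
  have hle : ∀ a, (σ a).toReal * f a ≤ (σ a).toReal * M := fun a =>
    mul_le_mul_of_nonneg_left (hf a) ENNReal.toReal_nonneg
  calc ∑' a, (σ a).toReal * f a ≤ ∑' a, (σ a).toReal * M :=
        Summable.tsum_le_tsum hle (Summable.of_nonneg_of_le
          (fun a => mul_nonneg ENNReal.toReal_nonneg (hf0 a)) hle (hs.mul_right M))
          (hs.mul_right M)
    _ = M := by rw [tsum_mul_right, h1, one_mul]
    _ ≤ b := hb

lemma summable_pmf_toNat {Act : Type*} (σ : PMF Act) (i : Act → Bool) :
    Summable fun a => (σ a).toReal * ((i a).toNat : ℝ) :=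
  Summable.of_nonneg_of_le (fun a => by positivity)
    (fun a => mul_le_of_le_one_right ENNReal.toReal_nonneg (toNat_le_one _))
    (ENNReal.summable_toReal σ.tsum_coe_ne_top)

/-- A maximum is at least any average over the actions. -/
lemma sum_mul_le_of_isMaxOn {K : ℕ} {Act : Type*} {I : Act → Fin K → Bool} (σ : PMF Act)
    {w : Fin K → ℝ} (hw : ∀ k, 0 ≤ w k) {a : Act}
    (hmax : ∀ b, ∑ k, w k * ((I b k).toNat : ℝ) ≤ ∑ k, w k * ((I a k).toNat : ℝ)) :
    ∑ k, w k * ∑' b, (σ b).toReal * ((I b k).toNat : ℝ) ≤ ∑ k, w k * ((I a k).toNat : ℝ) := by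
  have h1 : ∑ k, w k * ∑' b, (σ b).toReal * ((I b k).toNat : ℝ) =
      ∑' b, (σ b).toReal * ∑ k, w k * ((I b k).toNat : ℝ) := by
    simp_rw [← tsum_mul_left]
    rw [← Summable.tsum_finsetSum fun k _ => (summable_pmf_toNat σ fun b => I b k).mul_left (w k)]
    refine tsum_congr fun b => ?_
    rw [Finset.mul_sum]
    exact Finset.sum_congr rfl fun k _ => by ring
  rw [h1]
  exact tsum_pmf_mul_le σ (fun b => Finset.sum_nonneg fun k _ =>
    mul_nonneg (hw k) (Nat.cast_nonneg _)) hmax le_rfl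

lemma tsum_pmf_toNat_le_one {Act : Type*} (σ : PMF Act) (i : Act → Bool) :
    ∑' a, (σ a).toReal * ((i a).toNat : ℝ) ≤ 1 :=
  tsum_pmf_mul_le σ (fun _ => Nat.cast_nonneg _) (fun _ => toNat_le_one _) le_rfl

/-- The age-based UCB action nearly maximizes the age-weighted number of scheduled arms. -/
lemma sum_headAge_mul_le {K : ℕ} {St Act : Type*} {X : St → Fin K → Bool}
    {I : Act → Fin K → Bool} {η : ℝ} (hη : 0 ≤ η) (σ : PMF Act) {G : Fin K → ℕ → ℕ} {s : ℕ → St}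
    {a : ℕ → Act} {t : ℕ} (hmax : IsMaxOn (score X I η G s a t) Set.univ (a t))
    {y : Fin K → ℝ} (hy : ∀ k, y k ≤ ∑' b, (σ b).toReal * ((I b k).toNat : ℝ)) :
    ∑ k, (headAge (G k) (rewardPath X I s a k) t : ℝ) * y k ≤
      ∑ k, (headAge (G k) (rewardPath X I s a k) t : ℝ) * ((I (a t) k).toNat : ℝ) + K * η := by
  set z : Fin K → ℝ := fun k => (headAge (G k) (rewardPath X I s a k) t : ℝ)
  set u : Fin K → ℝ := fun k => ucb (fun τ => I (a τ) k) (rewardPath X I s a k) t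
  have hz : ∀ k, 0 ≤ z k := fun k => Nat.cast_nonneg _
  have hu : ∀ k, 0 ≤ u k := fun k => ucb_nonneg _ _ _
  have hw : ∀ k, 0 ≤ η * u k + z k := fun k => add_nonneg (mul_nonneg hη (hu k)) (hz k)
  have h1 := sum_mul_le_of_isMaxOn (I := I) σ hw (a := a t)
    fun b => isMaxOn_univ_iff.1 hmax b
  have hσ : ∀ k, 0 ≤ ∑' b, (σ b).toReal * ((I b k).toNat : ℝ) := fun k =>
    tsum_nonneg fun b => by positivity
  -- The estimates enter only through `0 ≤ u k` here and `u k ≤ 1` in the next bound, at a total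
  -- cost of `K * η`.
  have h2 : ∑ k, z k * y k ≤
      ∑ k, (η * u k + z k) * ∑' b, (σ b).toReal * ((I b k).toNat : ℝ) := by
    refine Finset.sum_le_sum fun k _ => (mul_le_mul_of_nonneg_left (hy k) (hz k)).trans ?_
    refine mul_le_mul_of_nonneg_right ?_ (hσ k)
    linarith [mul_nonneg hη (hu k)]
  have h3 : ∑ k, (η * u k + z k) * ((I (a t) k).toNat : ℝ) ≤
      ∑ k, (z k * ((I (a t) k).toNat : ℝ) + η) := by
    refine Finset.sum_le_sum fun k _ => ?_
    have hb := toNat_le_one (I (a t) k)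
    have hb0 : (0 : ℝ) ≤ (I (a t) k).toNat := Nat.cast_nonneg _
    have h4 : η * u k * ((I (a t) k).toNat : ℝ) ≤ η * 1 * 1 := by
      have := ucb_le_one (fun τ => I (a τ) k) (rewardPath X I s a k) t
      gcongr
    linarith
  rw [Finset.sum_add_distrib] at h3
  simp only [Finset.sum_const, Finset.card_univ, Fintype.card_fin, nsmul_eq_mul] at h3
  linarith

/-! ### The information that determines the sample path -/

section System

variable {K : ℕ} {Ω St Act : Type*}

/-- The rewards of arm `k` at the sample point `ω`. -/
def rewardsAt (X : St → Fin K → Bool) (I : Act → Fin K → Bool) (S : ℕ → Ω → St)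
    (A : ℕ → Ω → Act) (ω : Ω) (k : Fin K) : ℕ → Bool :=
  rewardPath X I (fun τ => S τ ω) (fun τ => A τ ω) k

/-- The position `ℓ_{k,t}` at the sample point `ω`. -/
def headIndex (X : St → Fin K → Bool) (I : Act → Fin K → Bool) (S : ℕ → Ω → St)
    (G : Fin K → ℕ → Ω → ℕ) (A : ℕ → Ω → Act) (t : ℕ) (ω : Ω) (k : Fin K) : ℕ :=
  nextToDepart (fun l => G k l ω) (rewardsAt X I S A ω k) t

/-- The head-of-line age `Z_{k,t}` at the sample point `ω`. -/
def ageAt (X : St → Fin K → Bool) (I : Act → Fin K → Bool) (S : ℕ → Ω → St)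
    (G : Fin K → ℕ → Ω → ℕ) (A : ℕ → Ω → Act) (t : ℕ) (ω : Ω) (k : Fin K) : ℕ :=
  headAge (fun l => G k l ω) (rewardsAt X I S A ω k) t

/-- What has been used by the beginning of slot `t`: the channels of the past slots and the gaps
before the head-of-line requests. -/
def revealed (X : St → Fin K → Bool) (I : Act → Fin K → Bool) (S : ℕ → Ω → St)
    (G : Fin K → ℕ → Ω → ℕ) (A : ℕ → Ω → Act) (t : ℕ) (ω : Ω) :
    (Fin K → List ℕ) × (Finset.Ico 1 t → Fin K → Bool) :=
  (fun k => (List.range (headIndex X I S G A t ω k)).map fun j => G k j ω,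
    fun τ => X (S τ ω))

/-- The state and the next gaps of a slot. -/
def freshAt (X : St → Fin K → Bool) (I : Act → Fin K → Bool) (S : ℕ → Ω → St)
    (G : Fin K → ℕ → Ω → ℕ) (A : ℕ → Ω → Act) (t : ℕ) (ω : Ω) : St × (Fin K → ℕ) :=
  (S t ω, fun k => G k (headIndex X I S G A t ω k) ω)

variable {X : St → Fin K → Bool} {I : Act → Fin K → Bool} {η : ℝ} {T : ℕ} {S : ℕ → Ω → St}
  {G : Fin K → ℕ → Ω → ℕ} {A : ℕ → Ω → Act}

/-- The ages of slots `σ ≤ t` involve only the gaps before the head-of-line request at `σ`, and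
these precede the head-of-line request at `t`. So past actions, past channels and these gaps fix the
whole age-augmented history. -/
lemma action_congr (hA : IsAgeBasedUCB X I η T S G A) {t : ℕ} (ht : t ∈ Finset.Icc 1 T)
    {ω ω' : Ω} (h1 : ∀ τ ∈ Finset.Ico 1 t, A τ ω = A τ ω')
    (hS : ∀ τ ∈ Finset.Ico 1 t, X (S τ ω) = X (S τ ω'))
    (hG : ∀ k, ∀ j < headIndex X I S G A t ω k, G k j ω = G k j ω') : A t ω = A t ω' := by
  have hr : ∀ k, ∀ τ ∈ Finset.Ico 1 t, rewardsAt X I S A ω k τ = rewardsAt X I S A ω' k τ :=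
    fun k τ hτ => by
      simp only [rewardsAt, rewardPath, reward]
      rw [h1 τ hτ, hS τ hτ]
  refine hA.ageBased t ht ?_
  refine Prod.ext (funext fun σ => Prod.ext (h1 σ σ.2) (funext fun k => hr k σ σ.2)) ?_
  refine funext fun σ => funext fun k => ?_
  have hσ := Finset.mem_Icc.1 σ.2
  have hlt : ∀ j < nextToDepart (fun l => G k l ω) (rewardsAt X I S A ω k) σ,
      G k j ω = G k j ω' := fun j hj => hG k j (hj.trans_le (nextToDepart_mono _ _ hσ.2))
  have e : nextToDepart (fun l => G k l ω) (rewardsAt X I S A ω k) σ =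
      nextToDepart (fun l => G k l ω') (rewardsAt X I S A ω' k) σ :=
    nextToDepart_congr (fun τ' hτ' => hr k τ' (by simp at hτ' ⊢; omega)) hlt
  change (σ : ℕ) - arrivalTime (fun l => G k l ω)
      (nextToDepart (fun l => G k l ω) (rewardsAt X I S A ω k) σ) =
    (σ : ℕ) - arrivalTime (fun l => G k l ω')
      (nextToDepart (fun l => G k l ω') (rewardsAt X I S A ω' k) σ)
  rw [← e, arrivalTime_congr hlt]

/-- Along two sample points with the same past channels and the same gaps before the head-of-line
requests of the first one, everything evolves identically. -/
lemma congr_of_agree (hA : IsAgeBasedUCB X I η T S G A) {t : ℕ} (ht : t ≤ T + 1) {ω ω' : Ω}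
    (hS : ∀ τ ∈ Finset.Ico 1 t, X (S τ ω) = X (S τ ω'))
    (hG : ∀ k, ∀ j < headIndex X I S G A t ω k, G k j ω = G k j ω') :
    (∀ τ ∈ Finset.Ico 1 t, A τ ω = A τ ω') ∧
      ∀ k, headIndex X I S G A t ω k = headIndex X I S G A t ω' k := by
  induction t with
  | zero => exact ⟨by simp, fun k => rfl⟩
  | succ t ih =>
    have hS' : ∀ τ ∈ Finset.Ico 1 t, X (S τ ω) = X (S τ ω') :=
      fun τ hτ => hS τ (by simp at hτ ⊢; omega)
    have hG' : ∀ k, ∀ j < headIndex X I S G A t ω k, G k j ω = G k j ω' :=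
      fun k j hj => hG k j (hj.trans_le (nextToDepart_le_succ _ _ t))
    obtain ⟨h1, -⟩ := ih (by omega) hS' hG'
    have hA' : ∀ τ ∈ Finset.Ico 1 (t + 1), A τ ω = A τ ω' := by
      intro τ hτ
      rcases Nat.lt_or_ge τ t with hlt | hge
      · exact h1 τ (by simp at hτ ⊢; omega)
      · obtain rfl : τ = t := by simp at hτ; omega
        exact action_congr hA (by simp at hτ ⊢; omega) h1 hS' hG'
    refine ⟨hA', fun k => nextToDepart_congr (fun τ hτ => ?_) (hG k)⟩
    simp only [rewardsAt, rewardPath, reward]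
    rw [hA' τ hτ, hS τ hτ]

/-- The head index behaves like a stopping time: agreement with the data of `ω` up to the head
indices of `ω` forces `ω'` to have the same head indices. Conversely, the lengths of the revealed
lists encode them. -/
lemma revealed_eq_iff (hA : IsAgeBasedUCB X I η T S G A) {t : ℕ} (ht : t ≤ T + 1) {ω ω' : Ω} :
    revealed X I S G A t ω' = revealed X I S G A t ω ↔
      (∀ τ ∈ Finset.Ico 1 t, X (S τ ω') = X (S τ ω)) ∧
        ∀ k, ∀ j < headIndex X I S G A t ω k, G k j ω' = G k j ω := by
  constructor
  · intro h
    refine ⟨fun τ hτ => congrFun (congrArg Prod.snd h) ⟨τ, hτ⟩, fun k j hj => ?_⟩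
    have h1 : (List.range (headIndex X I S G A t ω' k)).map (fun j => G k j ω') =
        (List.range (headIndex X I S G A t ω k)).map (fun j => G k j ω) :=
      congrFun (congrArg Prod.fst h) k
    have h2 : headIndex X I S G A t ω' k = headIndex X I S G A t ω k := by
      simpa using congrArg List.length h1
    rw [h2] at h1
    exact List.map_inj_left.1 h1 j (List.mem_range.2 hj)
  · rintro ⟨hS, hG⟩
    have h := (congr_of_agree hA ht (fun τ hτ => (hS τ hτ).symm)
      fun k j hj => (hG k j hj).symm).2
    refine Prod.ext (funext fun k => ?_) (funext fun τ => hS τ τ.2)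
    change List.map _ _ = List.map _ _
    rw [← h k]
    exact List.map_inj_left.2 fun j hj => hG k j (List.mem_range.1 hj)

lemma agree_of_revealed_eq (hA : IsAgeBasedUCB X I η T S G A) {t : ℕ} (ht : t ≤ T + 1)
    {ω ω' : Ω} (h : revealed X I S G A t ω' = revealed X I S G A t ω) :
    (∀ τ ∈ Finset.Ico 1 t, X (S τ ω') = X (S τ ω)) ∧
      ∀ k, ∀ j < headIndex X I S G A t ω' k, G k j ω' = G k j ω :=
  have h' := (revealed_eq_iff hA ht).1 h.symm
  ⟨fun τ hτ => (h'.1 τ hτ).symm, fun k j hj => (h'.2 k j hj).symm⟩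

lemma headIndex_eq_of_revealed_eq (hA : IsAgeBasedUCB X I η T S G A) {t : ℕ} (ht : t ≤ T + 1)
    {ω ω' : Ω} (h : revealed X I S G A t ω' = revealed X I S G A t ω) :
    headIndex X I S G A t ω' = headIndex X I S G A t ω :=
  have h' := agree_of_revealed_eq hA ht h
  funext (congr_of_agree hA ht h'.1 h'.2).2

lemma arrivalTime_eq_of_revealed_eq (hA : IsAgeBasedUCB X I η T S G A) {t : ℕ} (ht : t ≤ T + 1)
    {ω ω' : Ω} (h : revealed X I S G A t ω' = revealed X I S G A t ω) (k : Fin K) :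
    arrivalTime (fun l => G k l ω') (headIndex X I S G A t ω' k) =
      arrivalTime (fun l => G k l ω) (headIndex X I S G A t ω k) := by
  rw [headIndex_eq_of_revealed_eq hA ht h]
  exact arrivalTime_congr (((revealed_eq_iff hA ht).1 h).2 k)

lemma ageAt_eq_of_revealed_eq (hA : IsAgeBasedUCB X I η T S G A) {t : ℕ} (ht : t ≤ T + 1)
    {ω ω' : Ω} (h : revealed X I S G A t ω' = revealed X I S G A t ω) :
    ageAt X I S G A t ω' = ageAt X I S G A t ω :=
  funext fun k => congrArg (t - ·) (arrivalTime_eq_of_revealed_eq hA ht h k)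

lemma action_eq_of_revealed_eq (hA : IsAgeBasedUCB X I η T S G A) {t : ℕ}
    (ht : t ∈ Finset.Icc 1 T) {ω ω' : Ω}
    (h : revealed X I S G A t ω' = revealed X I S G A t ω) : A t ω' = A t ω := by
  have ht' : t ≤ T + 1 := by simp at ht; omega
  obtain ⟨hS, hG⟩ := agree_of_revealed_eq hA ht' h
  exact action_congr hA ht (congr_of_agree hA ht' hS hG).1 hS hG

lemma rewardsAt_eq_of_revealed_eq (hA : IsAgeBasedUCB X I η T S G A) {t : ℕ} (ht : t ≤ T + 1)
    {ω ω' : Ω} (h : revealed X I S G A t ω' = revealed X I S G A t ω) (k : Fin K) {τ : ℕ}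
    (hτ : τ ∈ Finset.Ico 1 t) : rewardsAt X I S A ω' k τ = rewardsAt X I S A ω k τ := by
  obtain ⟨hS, hG⟩ := agree_of_revealed_eq hA ht h
  simp only [rewardsAt, rewardPath, reward]
  rw [(congr_of_agree hA ht hS hG).1 τ hτ, hS τ hτ]

/-- With `ω₀` fixed, the random head indices become constants, so a fiber is an event about past
channels intersected with an event about finitely many fixed gaps. Independence applies to each. -/
lemma fiber_eq_inter (hA : IsAgeBasedUCB X I η T S G A) {t : ℕ} (ht : t ≤ T + 1) (ω₀ : Ω) :
    revealed X I S G A t ⁻¹' {revealed X I S G A t ω₀} =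
      {ω | ∀ τ ∈ Finset.Ico 1 t, X (S τ ω) = X (S τ ω₀)} ∩
        {ω | ∀ k, ∀ j < headIndex X I S G A t ω₀ k, G k j ω = G k j ω₀} :=
  Set.ext fun _ => revealed_eq_iff hA ht

lemma ageAt_succ_le_nextAge {t : ℕ} (ht : 1 ≤ t) (ω : Ω) :
    ageAt X I S G A (t + 1) ω ≤
      nextAge (ageAt X I S G A t ω) (fun k => X (freshAt X I S G A t ω).1 k && I (A t ω) k)
        (freshAt X I S G A t ω).2 :=
  fun _ => headAge_succ_le _ _ ht

end System

/-! ### Independence of the fresh state and gaps from the revealed information -/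

section Probability

variable {K : ℕ} {Ω St Act : Type*} [MeasurableSpace Ω] [MeasurableSpace St]
  {X : St → Fin K → Bool} {I : Act → Fin K → Bool} {η : ℝ} {T : ℕ} {S : ℕ → Ω → St}
  {G : Fin K → ℕ → Ω → ℕ} {A : ℕ → Ω → Act} {P : Measure Ω} {ν : Measure St} {p : Fin K → ℝ}

lemma measurable_channelVector (hX : ∀ k, Measurable (fun s => X s k)) : Measurable X :=
  measurable_pi_iff.2 hX

/-- Events about past channels are independent of the current state. -/
lemma measure_past_inter_state [IsProbabilityMeasure P] (hX : ∀ k, Measurable (fun s => X s k))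
    (hE : IsEnvironment P ν p T S G) {t : ℕ} (ht : t ∈ Finset.Icc 1 T) (x : ℕ → Fin K → Bool)
    {s : Set St} (hs : MeasurableSet s) :
    P ({ω | ∀ τ ∈ Finset.Ico 1 t, X (S τ ω) = x τ} ∩ S t ⁻¹' s) =
      P {ω | ∀ τ ∈ Finset.Ico 1 t, X (S τ ω) = x τ} * ν s := by
  classical
  let f : (τ : Finset.Icc 1 T) → Ω → St := fun τ => S τ
  let J : Finset (Finset.Icc 1 T) := Finset.univ.filter fun τ => (τ : ℕ) < t
  have hd : Disjoint J {⟨t, ht⟩} := by simp [J]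
  have hi := hE.state_indep.indepFun_finset J {⟨t, ht⟩} hd fun τ => hE.state_measurable τ τ.2
  have e1 : {ω | ∀ τ ∈ Finset.Ico 1 t, X (S τ ω) = x τ} =
      (fun ω (τ : J) => S τ ω) ⁻¹' {f | ∀ τ : J, X (f τ) = x τ} := by
    ext ω
    constructor
    · intro h τ
      have h1 := (Finset.mem_filter.1 τ.2).2
      have h2 := Finset.mem_Icc.1 τ.1.2
      exact h _ (by simp; omega)
    · intro h τ hτ
      have hτ' := Finset.mem_Ico.1 hτ
      have ht' := Finset.mem_Icc.1 ht
      exact h ⟨⟨τ, by simp; omega⟩, by simp [J]; omega⟩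
  have e2 : S t ⁻¹' s = (fun ω (τ : ({⟨t, ht⟩} : Finset (Finset.Icc 1 T))) => S τ ω) ⁻¹'
      {f | f ⟨⟨t, ht⟩, by simp⟩ ∈ s} := rfl
  have hm1 : MeasurableSet {f : J → St | ∀ τ : J, X (f τ) = x τ} := by
    rw [Set.ofPred_forall]
    refine MeasurableSet.iInter fun τ => ?_
    exact ((measurable_channelVector hX).comp (measurable_pi_apply τ))
      (measurableSet_singleton (x τ))
  have hm2 : MeasurableSet {f : ({⟨t, ht⟩} : Finset (Finset.Icc 1 T)) → St |
      f ⟨⟨t, ht⟩, by simp⟩ ∈ s} := measurable_pi_apply _ hs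
  have h := hi.meas_inter ⟨_, hm1, rfl⟩ ⟨_, hm2, rfl⟩
  rw [e1, e2, h, ← e2, ← Measure.map_apply (hE.state_measurable t ht) hs, hE.state_law t ht]

/-- Events about the first gaps are independent of the next gaps. -/
lemma measure_gaps_inter_next [IsProbabilityMeasure P]
    (hE : IsEnvironment P ν p T S G) {m : Fin K → Measure ℕ} (hm : ∀ k l, P.map (G k l) = m k)
    (l : Fin K → ℕ) (g : Fin K → ℕ → ℕ) (u : Set (Fin K → ℕ)) :
    P ({ω | ∀ k, ∀ j < l k, G k j ω = g k j} ∩ {ω | (fun k => G k (l k) ω) ∈ u}) =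
      P {ω | ∀ k, ∀ j < l k, G k j ω = g k j} * Measure.pi m u := by
  classical
  obtain ⟨N, hN⟩ : ∃ N, ∀ k, l k ≤ N :=
    ⟨∑ k, l k, fun k => Finset.single_le_sum (fun _ _ => Nat.zero_le _) (Finset.mem_univ k)⟩
  let J : Finset (Fin K × ℕ) := (Finset.univ ×ˢ Finset.range N).filter fun q => q.2 < l q.1
  let J' : Finset (Fin K × ℕ) := Finset.univ.image fun k => (k, l k)
  have hd : Disjoint J J' := by
    rw [Finset.disjoint_left]
    rintro q hq hq'
    obtain ⟨k, -, rfl⟩ := Finset.mem_image.1 hq'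
    exact lt_irrefl _ (Finset.mem_filter.1 hq).2
  have hi := hE.gap_indep.indepFun_finset J J' hd fun q => hE.gap_measurable q.1 q.2
  have e1 : {ω | ∀ k, ∀ j < l k, G k j ω = g k j} =
      (fun ω (q : J) => G q.1.1 q.1.2 ω) ⁻¹' {f | ∀ q : J, f q = g q.1.1 q.1.2} := by
    ext ω
    constructor
    · intro h q
      exact h _ _ (Finset.mem_filter.1 q.2).2
    · intro h k j hj
      exact h ⟨(k, j), by simp [J]; exact ⟨hj.trans_le (hN k), hj⟩⟩
  have hk : ∀ k, (k, l k) ∈ J' := fun k => Finset.mem_image_of_mem _ (Finset.mem_univ k)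
  have e2 : {ω | (fun k => G k (l k) ω) ∈ u} = (fun ω (q : J') => G q.1.1 q.1.2 ω) ⁻¹'
      {f | (fun k => f ⟨(k, l k), hk k⟩) ∈ u} := rfl
  have hm1 : MeasurableSet {f : J → ℕ | ∀ q : J, f q = g q.1.1 q.1.2} := by
    rw [Set.ofPred_forall]
    exact MeasurableSet.iInter fun q => measurable_pi_apply q (measurableSet_singleton _)
  have hu : MeasurableSet u := Set.Countable.measurableSet (Set.to_countable u)
  have hm2 : MeasurableSet {f : J' → ℕ | (fun k => f ⟨(k, l k), hk k⟩) ∈ u} :=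
    (measurable_pi_iff.2 fun k => measurable_pi_apply _ :
      Measurable fun (f : J' → ℕ) k => f ⟨(k, l k), hk k⟩) hu
  have h := hi.meas_inter ⟨_, hm1, rfl⟩ ⟨_, hm2, rfl⟩
  have hinj : Function.Injective fun k : Fin K => (k, l k) := fun a b h => (Prod.ext_iff.1 h).1
  have hpi := (hE.gap_indep.precomp hinj).map_fun_eq_pi_map
    fun k => (hE.gap_measurable k (l k)).aemeasurable
  have hpi' : P.map (fun ω k => G k (l k) ω) = Measure.pi m := by
    rw [← funext fun k => hm k (l k)]; exact hpi
  rw [e1, e2, h, ← e2, ← hpi', Measure.map_apply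
    (measurable_pi_iff.2 fun k => hE.gap_measurable k (l k)) hu]
  rfl

lemma measurableSet_past (hX : ∀ k, Measurable (fun s => X s k))
    (hE : IsEnvironment P ν p T S G) {t : ℕ} (ht : t ≤ T + 1) (x : ℕ → Fin K → Bool) :
    MeasurableSet {ω | ∀ τ ∈ Finset.Ico 1 t, X (S τ ω) = x τ} := by
  simp only [Set.ofPred_forall]
  refine MeasurableSet.iInter fun τ => MeasurableSet.iInter fun hτ => ?_
  exact ((measurable_channelVector hX).comp (hE.state_measurable τ (by simp at hτ ⊢; omega)))
    (measurableSet_singleton (x τ))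

lemma measurableSet_gaps (hE : IsEnvironment P ν p T S G) (l : Fin K → ℕ) (g : Fin K → ℕ → ℕ) :
    MeasurableSet {ω | ∀ k, ∀ j < l k, G k j ω = g k j} := by
  simp only [Set.ofPred_forall]
  exact MeasurableSet.iInter fun k => MeasurableSet.iInter fun j => MeasurableSet.iInter fun _ =>
    hE.gap_measurable k j (measurableSet_singleton _)

lemma measurableSet_fiber (hX : ∀ k, Measurable (fun s => X s k))
    (hE : IsEnvironment P ν p T S G) (hA : IsAgeBasedUCB X I η T S G A) {t : ℕ}
    (ht : t ≤ T + 1) (d : (Fin K → List ℕ) × (Finset.Ico 1 t → Fin K → Bool)) :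
    MeasurableSet (revealed X I S G A t ⁻¹' {d}) := by
  by_cases hd : ∃ ω₀, revealed X I S G A t ω₀ = d
  · obtain ⟨ω₀, rfl⟩ := hd
    rw [fiber_eq_inter hA ht]
    exact (measurableSet_past hX hE ht _).inter (measurableSet_gaps hE _ _)
  · convert MeasurableSet.empty
    ext ω
    simpa using fun h => hd ⟨ω, h⟩

/-- Everything that is a function of the revealed information is measurable. -/
lemma measurable_of_revealed {β : Type*} [MeasurableSpace β]
    (hX : ∀ k, Measurable (fun s => X s k))
    (hE : IsEnvironment P ν p T S G) (hA : IsAgeBasedUCB X I η T S G A) {t : ℕ}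
    (ht : t ≤ T + 1) {f : Ω → β}
    (hf : ∀ ω ω', revealed X I S G A t ω' = revealed X I S G A t ω → f ω' = f ω) :
    Measurable f := by
  intro s _
  -- The revealed data (lists of naturals and Boolean vectors) take countably many values, so every
  -- preimage is a countable union of measurable fibers.
  have : f ⁻¹' s = ⋃ d ∈ revealed X I S G A t '' (f ⁻¹' s), revealed X I S G A t ⁻¹' {d} := by
    ext ω
    simp only [Set.mem_preimage, Set.mem_iUnion, Set.mem_singleton_iff, Set.mem_image]
    constructor
    · exact fun h => ⟨_, ⟨ω, h, rfl⟩, rfl⟩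
    · rintro ⟨_, ⟨ω', h', rfl⟩, h⟩
      rwa [hf ω' ω h]
  rw [this]
  exact MeasurableSet.biUnion (Set.to_countable _) fun d _ => measurableSet_fiber hX hE hA ht d

/-- On a fiber the fresh variables are the state `S t` and the gaps at constant indices.
Probabilities of rectangles factor by three independences: states from gaps, past states from the
current one, and earlier gaps from the next ones. -/
lemma lintegral_fiber [IsProbabilityMeasure P] [IsProbabilityMeasure ν]
    (hX : ∀ k, Measurable (fun s => X s k))
    (hE : IsEnvironment P ν p T S G) (hA : IsAgeBasedUCB X I η T S G A)
    {m : Fin K → Measure ℕ} [∀ k, IsProbabilityMeasure (m k)] (hm : ∀ k l, P.map (G k l) = m k)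
    {t : ℕ} (ht : t ∈ Finset.Icc 1 T) (ω₀ : Ω) {F : St × (Fin K → ℕ) → ENNReal}
    (hF : Measurable F) :
    ∫⁻ ω in revealed X I S G A t ⁻¹' {revealed X I S G A t ω₀},
        F (freshAt X I S G A t ω) ∂P =
      P (revealed X I S G A t ⁻¹' {revealed X I S G A t ω₀}) *
        ∫⁻ q, F q ∂(ν.prod (Measure.pi m)) := by
  have ht' : t ≤ T + 1 := by simp at ht; omega
  set l := headIndex X I S G A t ω₀
  set C := revealed X I S G A t ⁻¹' {revealed X I S G A t ω₀}
  have hC : MeasurableSet C := measurableSet_fiber hX hE hA ht' _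
  let N : Ω → St × (Fin K → ℕ) := fun ω => (S t ω, fun k => G k (l k) ω)
  have hN : Measurable N := (hE.state_measurable t ht).prodMk
    (measurable_pi_iff.2 fun k => hE.gap_measurable k (l k))
  have e1 : ∫⁻ ω in C, F (freshAt X I S G A t ω) ∂P = ∫⁻ ω in C, F (N ω) ∂P := by
    refine setLIntegral_congr_fun hC fun ω hω => ?_
    change F (S t ω, fun k => G k (headIndex X I S G A t ω k) ω) = _
    rw [headIndex_eq_of_revealed_eq hA ht' hω]
  have hmap : (P.restrict C).map N = P C • ν.prod (Measure.pi m) := by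
    have h2 : (P C • ν).prod (Measure.pi m) = (P.restrict C).map N := by
      have : IsFiniteMeasure (P C • ν) := ν.smul_finite (measure_ne_top P C)
      refine Measure.prod_eq fun s u hs hu => ?_
      rw [Measure.map_apply hN (hs.prod hu), Measure.restrict_apply (hN (hs.prod hu))]
      set A1 := {ω | ∀ τ ∈ Finset.Ico 1 t, X (S τ ω) = X (S τ ω₀)}
      set B1 := {ω | ∀ k, ∀ j < l k, G k j ω = G k j ω₀}
      have hCeq : C = A1 ∩ B1 := fiber_eq_inter hA ht' ω₀
      -- past and current states against gaps
      have hA1 : MeasurableSet[MeasurableSpace.comap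
          (fun ω (t : Finset.Icc 1 T) => S t ω) inferInstance] A1 := by
        refine ⟨{f | ∀ τ : Finset.Icc 1 T, (τ : ℕ) < t → X (f τ) = X (S τ ω₀)}, ?_, ?_⟩
        · simp only [Set.ofPred_forall]
          refine MeasurableSet.iInter fun τ => MeasurableSet.iInter fun _ => ?_
          exact ((measurable_channelVector hX).comp (measurable_pi_apply τ))
            (measurableSet_singleton _)
        · ext ω
          constructor
          · intro h τ hτ
            have h1 := Finset.mem_Ico.1 hτ
            have h2 := Finset.mem_Icc.1 ht
            exact h ⟨τ, by simp; omega⟩ h1.2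
          · intro h τ hτ
            have h2 := Finset.mem_Icc.1 τ.2
            exact h τ (by simp; omega)
      have hS1 : MeasurableSet[MeasurableSpace.comap
          (fun ω (t : Finset.Icc 1 T) => S t ω) inferInstance] (S t ⁻¹' s) :=
        ⟨{f | f ⟨t, ht⟩ ∈ s}, measurable_pi_apply _ hs, rfl⟩
      have hB1 : MeasurableSet[MeasurableSpace.comap
          (fun ω (q : Fin K × ℕ) => G q.1 q.2 ω) inferInstance] B1 := by
        refine ⟨{f | ∀ k, ∀ j < l k, f (k, j) = G k j ω₀}, ?_, rfl⟩
        simp only [Set.ofPred_forall]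
        exact MeasurableSet.iInter fun k => MeasurableSet.iInter fun j =>
          MeasurableSet.iInter fun _ => measurable_pi_apply _ (measurableSet_singleton _)
      have hU1 : MeasurableSet[MeasurableSpace.comap
          (fun ω (q : Fin K × ℕ) => G q.1 q.2 ω) inferInstance]
          {ω | (fun k => G k (l k) ω) ∈ u} :=
        ⟨{f | (fun k => f (k, l k)) ∈ u},
          (measurable_pi_iff.2 fun k => measurable_pi_apply _ :
            Measurable fun (f : Fin K × ℕ → ℕ) k => f (k, l k)) hu, rfl⟩
      have i1 := hE.indep.meas_inter hA1 hB1
      have i2 := hE.indep.meas_inter (hA1.inter hS1) (hB1.inter hU1)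
      have e : N ⁻¹' s ×ˢ u ∩ C = A1 ∩ S t ⁻¹' s ∩ (B1 ∩ {ω | (fun k => G k (l k) ω) ∈ u}) := by
        rw [hCeq]
        ext ω
        simp only [N, Set.mem_inter_iff, Set.mem_preimage, Set.mem_prod, Set.mem_ofPred_eq]
        tauto
      rw [e, i2, measure_past_inter_state hX hE ht _ hs, measure_gaps_inter_next hE hm, hCeq,
        i1, Measure.smul_apply, smul_eq_mul]
      ring
    rw [← h2, Measure.prod_smul_left]
  rw [e1, ← lintegral_map hF hN, hmap, lintegral_smul_measure, smul_eq_mul]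

/-- Comparison of integrals fiber by fiber. -/
lemma lintegral_le_of_fiber_le (hX : ∀ k, Measurable (fun s => X s k))
    (hE : IsEnvironment P ν p T S G) (hA : IsAgeBasedUCB X I η T S G A) {t : ℕ}
    (ht : t ≤ T + 1) {f g : Ω → ENNReal}
    (h : ∀ ω₀, ∫⁻ ω in revealed X I S G A t ⁻¹' {revealed X I S G A t ω₀}, f ω ∂P ≤
      ∫⁻ ω in revealed X I S G A t ⁻¹' {revealed X I S G A t ω₀}, g ω ∂P) :
    ∫⁻ ω, f ω ∂P ≤ ∫⁻ ω, g ω ∂P := by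
  -- Splitting over countably many measurable fibers needs no measurability of `f`.
  have key : ∀ f : Ω → ENNReal, ∫⁻ ω, f ω ∂P =
      ∑' d, ∫⁻ ω in revealed X I S G A t ⁻¹' {d}, f ω ∂P := fun f => by
    rw [← lintegral_iUnion (fun d => measurableSet_fiber hX hE hA ht d) _ f,
      ← Set.preimage_iUnion, Set.iUnion_of_singleton, Set.preimage_univ, Measure.restrict_univ]
    intro a b hab
    exact Disjoint.preimage _ (by simpa using hab)
  rw [key, key]
  refine ENNReal.tsum_le_tsum fun d => ?_
  by_cases hd : ∃ ω₀, revealed X I S G A t ω₀ = d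
  · obtain ⟨ω₀, rfl⟩ := hd
    exact h ω₀
  · have : revealed X I S G A t ⁻¹' {d} = ∅ := by
      ext ω
      simpa using fun h => hd ⟨ω, h⟩
    simp [this]

/-- Conditioning on the revealed information, the fresh variables keep their law. -/
lemma lintegral_revealed_fresh [IsProbabilityMeasure P] [IsProbabilityMeasure ν]
    (hX : ∀ k, Measurable (fun s => X s k))
    (hE : IsEnvironment P ν p T S G) (hA : IsAgeBasedUCB X I η T S G A)
    {m : Fin K → Measure ℕ} [∀ k, IsProbabilityMeasure (m k)] (hm : ∀ k l, P.map (G k l) = m k)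
    {t : ℕ} (ht : t ∈ Finset.Icc 1 T) {F : Ω → St × (Fin K → ℕ) → ENNReal}
    (hF : ∀ ω, Measurable (F ω))
    (hF' : ∀ ω ω', revealed X I S G A t ω' = revealed X I S G A t ω → F ω' = F ω) :
    ∫⁻ ω, F ω (freshAt X I S G A t ω) ∂P =
      ∫⁻ ω, ∫⁻ q, F ω q ∂(ν.prod (Measure.pi m)) ∂P := by
  have ht' : t ≤ T + 1 := by simp at ht; omega
  have key : ∀ ω₀, ∫⁻ ω in revealed X I S G A t ⁻¹' {revealed X I S G A t ω₀},
      F ω (freshAt X I S G A t ω) ∂P =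
      ∫⁻ ω in revealed X I S G A t ⁻¹' {revealed X I S G A t ω₀},
        ∫⁻ q, F ω q ∂(ν.prod (Measure.pi m)) ∂P := fun ω₀ => by
    have hC := measurableSet_fiber hX hE hA ht' (revealed X I S G A t ω₀)
    rw [setLIntegral_congr_fun hC (g := fun ω => F ω₀ (freshAt X I S G A t ω))
        fun ω hω => by simp only [hF' ω₀ ω hω],
      lintegral_fiber hX hE hA hm ht ω₀ (hF ω₀),
      setLIntegral_congr_fun hC (g := fun _ => ∫⁻ q, F ω₀ q ∂(ν.prod (Measure.pi m)))
        fun ω hω => by simp only [hF' ω₀ ω hω],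
      setLIntegral_const, mul_comm]
  exact le_antisymm (lintegral_le_of_fiber_le hX hE hA ht' fun ω₀ => (key ω₀).le)
    (lintegral_le_of_fiber_le hX hE hA ht' fun ω₀ => (key ω₀).ge)

end Probability

/-! ### Mean number of arrivals of a geometric renewal process -/

section Renewal

variable {Ω : Type*} [MeasurableSpace Ω] {P : Measure Ω}
  {g : ℕ → Ω → ℕ} {m : Measure ℕ} {p : ℝ}

lemma measurable_arrivalTime (hg : ∀ l, Measurable (g l)) (l : ℕ) :
    Measurable fun ω => arrivalTime (fun j => g j ω) l :=
  Finset.measurable_sum _ fun j _ => hg j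

lemma indepFun_arrivalTime (hg : ∀ l, Measurable (g l)) (hi : iIndepFun g P) (l : ℕ) :
    IndepFun (fun ω => arrivalTime (fun j => g j ω) l) (g l) P := by
  have h := hi.indepFun_finset (Finset.range l) {l} (by simp) hg
  exact h.comp (φ := fun f : Finset.range l → ℕ => ∑ j, f j)
    (ψ := fun f : ({l} : Finset ℕ) → ℕ => f ⟨l, by simp⟩)
    (Finset.measurable_sum _ fun j _ => measurable_pi_apply j) (measurable_pi_apply _) |>.congr
    (ae_of_all _ fun ω => Finset.sum_coe_sort (Finset.range l) fun j => g j ω)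
    (ae_of_all _ fun ω => rfl)

variable [IsProbabilityMeasure P]

/-- Integrate the geometric distribution function of the last gap over the independent arrival time
before it. Truncated subtraction gives the value `0` when that arrival is already later than `n`. -/
lemma measure_arrivalTime_succ_le (hg : ∀ l, Measurable (g l)) (hi : iIndepFun g P)
    (hm : ∀ l, P.map (g l) = m) (hG : GeomLaw p m) (hp : 0 < p) (hp1 : p < 1) (l n : ℕ) :
    P {ω | arrivalTime (fun j => g j ω) (l + 1) ≤ n} =
      ∫⁻ ω, ENNReal.ofReal (1 - (1 - p) ^ (n - arrivalTime (fun j => g j ω) l)) ∂P := by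
  have hτ := measurable_arrivalTime hg l
  have hmap := (indepFun_iff_map_prod_eq_prod_map_map hτ.aemeasurable (hg l).aemeasurable).1
    (indepFun_arrivalTime hg hi l)
  have hprob : IsProbabilityMeasure m := hG.isProbabilityMeasure hp hp1
  have hs : MeasurableSet {q : ℕ × ℕ | q.1 + q.2 ≤ n} :=
    (Set.to_countable _).measurableSet
  have e1 : {ω | arrivalTime (fun j => g j ω) (l + 1) ≤ n} =
      (fun ω => (arrivalTime (fun j => g j ω) l, g l ω)) ⁻¹' {q : ℕ × ℕ | q.1 + q.2 ≤ n} := by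
    ext ω
    simp only [Set.mem_ofPred_eq, Set.mem_preimage, arrivalTime_succ]
  rw [e1, ← Measure.map_apply (hτ.prodMk (hg l)) hs, hmap, hm l, Measure.prod_apply hs,
    lintegral_map (measurable_of_countable _) hτ]
  refine lintegral_congr fun ω => ?_
  rw [← hG.measure_le hp hp1]
  set a := arrivalTime (fun j => g j ω) l
  rcases le_or_gt a n with h | h
  · congr 1
    ext j
    simp only [Set.mem_ofPred_eq, Set.mem_preimage]
    omega
  · have e2 : Prod.mk a ⁻¹' {q : ℕ × ℕ | q.1 + q.2 ≤ n} = ∅ := by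
      refine Set.eq_empty_of_forall_notMem fun j hj => ?_
      have hj' : a + j ≤ n := hj
      omega
    rw [e2, hG.measure_le hp hp1, Nat.sub_eq_zero_of_le h.le]
    simp

/-- Memorylessness, from the pointwise identity `1 - q ^ (j + 1) = q (1 - q ^ j) + p` with `q = 1 -
p`. -/
lemma measure_arrivalTime_recursion (hg : ∀ l, Measurable (g l)) (hi : iIndepFun g P)
    (hm : ∀ l, P.map (g l) = m) (hG : GeomLaw p m) (hp : 0 < p) (hp1 : p < 1) (l n : ℕ) :
    P {ω | arrivalTime (fun j => g j ω) (l + 1) ≤ n + 1} =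
      ENNReal.ofReal (1 - p) * P {ω | arrivalTime (fun j => g j ω) (l + 1) ≤ n} +
        ENNReal.ofReal p * P {ω | arrivalTime (fun j => g j ω) l ≤ n} := by
  have hτ := measurable_arrivalTime hg l
  have hs : MeasurableSet {ω | arrivalTime (fun j => g j ω) l ≤ n} := measurableSet_le hτ
    measurable_const
  have hmeas : Measurable fun ω =>
      ENNReal.ofReal (1 - (1 - p) ^ (n - arrivalTime (fun j => g j ω) l)) :=
    (measurable_of_countable fun a : ℕ => ENNReal.ofReal (1 - (1 - p) ^ (n - a))).comp hτ
  rw [measure_arrivalTime_succ_le hg hi hm hG hp hp1,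
    measure_arrivalTime_succ_le hg hi hm hG hp hp1, ← lintegral_const_mul _ hmeas,
    ← lintegral_indicator_one hs, ← lintegral_const_mul _ (measurable_one.indicator hs),
    ← lintegral_add_left (hmeas.const_mul _)]
  refine lintegral_congr fun ω => ?_
  set a := arrivalTime (fun j => g j ω) l with ha
  have hq : 0 ≤ 1 - p := by linarith
  have hpow : 0 ≤ 1 - (1 - p) ^ (n - a) := by
    have := pow_le_one₀ (n := n - a) hq (by linarith); linarith
  rcases le_or_gt a n with h | h
  · rw [Set.indicator_of_mem (by simpa [ha] using h), Pi.one_apply, mul_one,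
      ← ENNReal.ofReal_mul hq, ← ENNReal.ofReal_add (mul_nonneg hq hpow) hp.le,
      Nat.succ_sub h, pow_succ]
    congr 1
    ring
  · rw [Set.indicator_of_notMem (by simpa [ha] using h), mul_zero, add_zero,
      Nat.sub_eq_zero_of_le h.le, Nat.sub_eq_zero_of_le h]
    simp

/-- The expected number of arrivals up to slot `n` is at most `p n`. -/
lemma sum_measure_arrivalTime_le (hg : ∀ l, Measurable (g l)) (hi : iIndepFun g P)
    (hm : ∀ l, P.map (g l) = m) (hG : GeomLaw p m) (hp : 0 < p) (hp1 : p < 1) (L n : ℕ) :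
    ∑ l ∈ Finset.range L, P {ω | arrivalTime (fun j => g j ω) (l + 1) ≤ n} ≤
      n * ENNReal.ofReal p := by
  induction n with
  | zero =>
    rw [Nat.cast_zero, zero_mul, nonpos_iff_eq_zero]
    refine Finset.sum_eq_zero fun l _ => ?_
    rw [measure_arrivalTime_succ_le hg hi hm hG hp hp1]
    simp
  | succ n ih =>
    simp_rw [measure_arrivalTime_recursion hg hi hm hG hp hp1]
    rw [Finset.sum_add_distrib, ← Finset.mul_sum, ← Finset.mul_sum]
    set s := ∑ l ∈ Finset.range L, P {ω | arrivalTime (fun j => g j ω) (l + 1) ≤ n}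
    -- Shifting the index adds only the term of `τ(0) = 0`, at most one; each slot therefore adds at
    -- most `p` to the expected count.
    have h1 : ∑ l ∈ Finset.range L, P {ω | arrivalTime (fun j => g j ω) l ≤ n} ≤ s + 1 := by
      calc _ ≤ ∑ l ∈ Finset.range (L + 1), P {ω | arrivalTime (fun j => g j ω) l ≤ n} :=
            Finset.sum_le_sum_of_subset (Finset.range_mono (Nat.le_succ L))
        _ = s + P {ω | arrivalTime (fun j => g j ω) 0 ≤ n} := Finset.sum_range_succ' _ _
        _ ≤ s + 1 := by gcongr; exact prob_le_one
    calc _ ≤ ENNReal.ofReal (1 - p) * s + ENNReal.ofReal p * (s + 1) := by gcongr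
      _ = (ENNReal.ofReal (1 - p) + ENNReal.ofReal p) * s + ENNReal.ofReal p := by ring
      _ = s + ENNReal.ofReal p := by
        rw [← ENNReal.ofReal_add (by linarith) hp.le, sub_add_cancel, ENNReal.ofReal_one, one_mul]
      _ ≤ n * ENNReal.ofReal p + ENNReal.ofReal p := by gcongr
      _ = _ := by push_cast; ring

/-- The reward path is arbitrary, with no independence required: departures never outnumber
arrivals. -/
lemma lintegral_nextToDepart_le (hg : ∀ l, Measurable (g l)) (hi : iIndepFun g P)
    (hm : ∀ l, P.map (g l) = m) (hG : GeomLaw p m) (hp : 0 < p) (hp1 : p < 1)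
    (r : Ω → ℕ → Bool) {t : ℕ} (ht : 1 ≤ t) :
    ∫⁻ ω, (nextToDepart (fun j => g j ω) (r ω) t : ENNReal) ∂P ≤
      1 + ((t - 1 : ℕ) : ENNReal) * ENNReal.ofReal p := by
  have hs : ∀ l, MeasurableSet {ω | arrivalTime (fun j => g j ω) l ≤ t - 1} := fun l =>
    measurableSet_le (measurable_arrivalTime hg l) measurable_const
  have h1 : ∀ ω, (nextToDepart (fun j => g j ω) (r ω) t : ENNReal) ≤
      1 + ∑ l ∈ Finset.range (t - 1),
        {ω | arrivalTime (fun j => g j ω) (l + 1) ≤ t - 1}.indicator (1 : Ω → ENNReal) ω :=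
    fun ω => by
      have h := nextToDepart_le_card (fun j => g j ω) (r ω) ht
      rw [Finset.sum_Ico_eq_sum_range] at h
      have h' : (nextToDepart (fun j => g j ω) (r ω) t : ENNReal) ≤
          ((1 + ∑ l ∈ Finset.range (t - 1),
            if arrivalTime (fun j => g j ω) (1 + l) ≤ t - 1 then 1 else 0 : ℕ) : ENNReal) := by
        exact_mod_cast h
      refine h'.trans_eq ?_
      push_cast
      congr 1
      refine Finset.sum_congr rfl fun l _ => ?_
      simp only [Set.indicator_apply, Set.mem_ofPred_eq, Pi.one_apply, add_comm 1 l]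
  refine (lintegral_mono h1).trans ?_
  rw [lintegral_add_left measurable_const, lintegral_finsetSum _
    fun l _ => measurable_one.indicator (hs (l + 1))]
  simp_rw [lintegral_indicator_one (hs _)]
  rw [lintegral_const, measure_univ, mul_one]
  gcongr
  exact sum_measure_arrivalTime_le hg hi hm hG hp hp1 _ _

end Renewal

/-! ### Wald's identity for departures -/

section Wald

variable {K : ℕ} {Ω St Act : Type*} [MeasurableSpace Ω] [MeasurableSpace St]
  {X : St → Fin K → Bool} {I : Act → Fin K → Bool} {η : ℝ} {T : ℕ} {S : ℕ → Ω → St}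
  {G : Fin K → ℕ → Ω → ℕ} {A : ℕ → Ω → Act} {P : Measure Ω} {ν : Measure St} {p : Fin K → ℝ}

lemma measurable_of_channel_gaps {β : Type*} [MeasurableSpace β]
    (hX : ∀ k, Measurable (fun s => X s k)) (f : (Fin K → Bool) × (Fin K → ℕ) → β) :
    Measurable fun q : St × (Fin K → ℕ) => f (X q.1, q.2) :=
  (measurable_of_countable f).comp
    (((measurable_channelVector hX).comp measurable_fst).prodMk measurable_snd)

/-- Both sides equal the channel rate, because the gap has mean `1 / p k` and is independent of the
channel. This is the increment of Wald's identity in one slot. -/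
lemma lintegral_channel_eq [IsProbabilityMeasure ν] {m : Fin K → Measure ℕ}
    [∀ k, IsProbabilityMeasure (m k)] (hX : ∀ k, Measurable (fun s => X s k))
    (hG : ∀ k, GeomLaw (p k) (m k)) (hp : ∀ k, 0 < p k) (hp1 : ∀ k, p k < 1) (k : Fin K) :
    ∫⁻ q : St × (Fin K → ℕ), (if X q.1 k = true then 1 else 0) ∂(ν.prod (Measure.pi m)) =
      ENNReal.ofReal (p k) * ∫⁻ q : St × (Fin K → ℕ),
        (if X q.1 k = true then (q.2 k : ENNReal) else 0) ∂(ν.prod (Measure.pi m)) := by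
  have key : ∀ f : ℕ → ℝ, (∀ n, 0 ≤ f n) → Integrable f (m k) →
      ∫⁻ q : St × (Fin K → ℕ), (if X q.1 k = true then ENNReal.ofReal (f (q.2 k)) else 0)
        ∂(ν.prod (Measure.pi m)) = ENNReal.ofReal (channelRate ν X k * ∫ n, f n ∂m k) :=
    fun f hf hfi => by
      have h := integral_channel_mul (ν := ν) hX k hfi
      rw [← h.2, ofReal_integral_eq_lintegral_ofReal h.1
        (ae_of_all _ fun q => mul_nonneg (Nat.cast_nonneg _) (hf _))]
      refine lintegral_congr fun q => ?_
      cases X q.1 k <;> simp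
  have h1 := key (fun _ => 1) (fun _ => zero_le_one) (integrable_const _)
  have h2 := key (fun n => n) (fun n => Nat.cast_nonneg n)
    ((hG k).integral_id (hp k) (hp1 k)).1
  simp only [ENNReal.ofReal_one, ENNReal.ofReal_natCast] at h1 h2
  rw [h1, h2, ((hG k).integral_id (hp k) (hp1 k)).2, ← ENNReal.ofReal_mul (hp k).le]
  congr 1
  have := hp k
  simp
  field_simp

/-- Wald's identity for the departures of one arm. -/
lemma lintegral_headIndex_eq [IsProbabilityMeasure P] [IsProbabilityMeasure ν]
    (hX : ∀ k, Measurable (fun s => X s k))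
    (hE : IsEnvironment P ν p T S G) (hA : IsAgeBasedUCB X I η T S G A)
    {m : Fin K → Measure ℕ} [∀ k, IsProbabilityMeasure (m k)] (hm : ∀ k l, P.map (G k l) = m k)
    (hG : ∀ k, GeomLaw (p k) (m k)) (hp : ∀ k, 0 < p k) (hp1 : ∀ k, p k < 1) (k : Fin K)
    {t : ℕ} (ht : 1 ≤ t) (htT : t ≤ T + 1) :
    ∫⁻ ω, (headIndex X I S G A t ω k : ENNReal) ∂P = ENNReal.ofReal (p k) *
      ∫⁻ ω, (arrivalTime (fun l => G k l ω) (headIndex X I S G A t ω k) : ENNReal) ∂P := by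
  induction t, ht using Nat.le_induction with
  | base =>
    have e : ∀ ω, headIndex X I S G A 1 ω k = 1 := fun ω => nextToDepart_one _ _
    simp only [e, arrivalTime, Finset.sum_range_one, Nat.cast_one, lintegral_const, measure_univ,
      mul_one]
    rw [← lintegral_map (measurable_of_countable fun n : ℕ => (n : ENNReal))
      (hE.gap_measurable k 0), hm k 0]
    have h := ((hG k).integral_id (hp k) (hp1 k))
    have h2 := ofReal_integral_eq_lintegral_ofReal h.1 (ae_of_all _ fun n => Nat.cast_nonneg n)
    simp only [ENNReal.ofReal_natCast] at h2
    rw [← h2, h.2, ← ENNReal.ofReal_mul (hp k).le, mul_one_div_cancel (hp k).ne',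
      ENNReal.ofReal_one]
  | succ t ht ih =>
    have htm : t ∈ Finset.Icc 1 T := by simp; omega
    have ht' : t ≤ T + 1 := by omega
    let a : Ω → ℕ := fun ω => arrivalTime (fun l => G k l ω) (headIndex X I S G A t ω k)
    -- `F1` and `F2` are the increments of the position and of its arrival time. Whether the arm is
    -- scheduled with a request present is revealed; the channel and the gap are fresh.
    let F1 : Ω → St × (Fin K → ℕ) → ENNReal := fun ω q =>
      if I (A t ω) k = true ∧ a ω ≤ t then (if X q.1 k = true then 1 else 0) else 0
    let F2 : Ω → St × (Fin K → ℕ) → ENNReal := fun ω q =>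
      if I (A t ω) k = true ∧ a ω ≤ t then (if X q.1 k = true then (q.2 k : ENNReal) else 0)
      else 0
    have ha : ∀ ω ω', revealed X I S G A t ω' = revealed X I S G A t ω → a ω' = a ω :=
      fun ω ω' h => arrivalTime_eq_of_revealed_eq hA ht' h k
    have hF1 := lintegral_revealed_fresh hX hE hA hm htm (F := F1)
      (fun ω => measurable_of_channel_gaps hX fun q =>
        if I (A t ω) k = true ∧ a ω ≤ t then (if q.1 k = true then 1 else 0) else 0)
      fun ω ω' h => by
        simp only [F1, ha ω ω' h, action_eq_of_revealed_eq hA htm h]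
    have hF2 := lintegral_revealed_fresh hX hE hA hm htm (F := F2)
      (fun ω => measurable_of_channel_gaps hX fun q =>
        if I (A t ω) k = true ∧ a ω ≤ t then (if q.1 k = true then (q.2 k : ENNReal) else 0)
        else 0)
      fun ω ω' h => by
        simp only [F2, ha ω ω' h, action_eq_of_revealed_eq hA htm h]
    have hF12 : ∀ ω, ∫⁻ q, F1 ω q ∂(ν.prod (Measure.pi m)) =
        ENNReal.ofReal (p k) * ∫⁻ q, F2 ω q ∂(ν.prod (Measure.pi m)) := fun ω => by
      by_cases hc : I (A t ω) k = true ∧ a ω ≤ t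
      · simp only [F1, F2, if_pos hc]
        exact lintegral_channel_eq hX hG hp hp1 k
      · simp [F1, F2, if_neg hc]
    simp_rw [hF12] at hF1
    rw [lintegral_const_mul' _ _ ENNReal.ofReal_ne_top, ← hF2] at hF1
    have hdep : ∀ ω, (1 ≤ t ∧ rewardsAt X I S A ω k t = true ∧ a ω ≤ t) ↔
        (I (A t ω) k = true ∧ a ω ≤ t) ∧ X (S t ω) k = true := fun ω => by
      simp only [rewardsAt, rewardPath, reward, Bool.and_eq_true]
      tauto
    have hsucc : ∀ ω, headIndex X I S G A (t + 1) ω k =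
        if (I (A t ω) k = true ∧ a ω ≤ t) ∧ X (S t ω) k = true then headIndex X I S G A t ω k + 1
        else headIndex X I S G A t ω k := fun ω =>
      (nextToDepart_succ _ _ t).trans (if_congr (hdep ω) rfl rfl)
    have e1 : ∀ ω, (headIndex X I S G A (t + 1) ω k : ENNReal) =
        headIndex X I S G A t ω k + F1 ω (freshAt X I S G A t ω) := fun ω => by
      rw [hsucc]
      by_cases hc : I (A t ω) k = true ∧ a ω ≤ t
      · by_cases hx : X (S t ω) k = true <;> simp [F1, freshAt, hc, hx]
      · simp [F1, hc]
    have e2 : ∀ ω, (arrivalTime (fun l => G k l ω) (headIndex X I S G A (t + 1) ω k) : ENNReal) =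
        (a ω : ENNReal) + F2 ω (freshAt X I S G A t ω) := fun ω => by
      rw [hsucc]
      by_cases hc : I (A t ω) k = true ∧ a ω ≤ t
      · by_cases hx : X (S t ω) k = true
        · rw [if_pos ⟨hc, hx⟩, arrivalTime_succ]
          simp [F2, freshAt, hc, hx, a]
        · simp [F2, freshAt, hx, a]
      · rw [if_neg fun h => hc h.1]
        simp [F2, hc, a]
    have hmh : Measurable fun ω => (headIndex X I S G A t ω k : ENNReal) :=
      measurable_of_revealed hX hE hA ht' fun ω ω' h => by
        rw [headIndex_eq_of_revealed_eq hA ht' h]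
    have hma : Measurable fun ω => (a ω : ENNReal) :=
      measurable_of_revealed hX hE hA ht' fun ω ω' h => by rw [ha ω ω' h]
    simp_rw [e1, e2]
    rw [lintegral_add_left hmh, lintegral_add_left hma, mul_add, hF1, ih ht']

end Wald

/-! ### Uniform bounds on the age norm -/

section Stability

variable {K : ℕ} {Ω St Act : Type*} [MeasurableSpace Ω] [MeasurableSpace St]
  {X : St → Fin K → Bool} {I : Act → Fin K → Bool} {η : ℝ} {T : ℕ} {S : ℕ → Ω → St}
  {G : Fin K → ℕ → Ω → ℕ} {A : ℕ → Ω → Act} {P : Measure Ω} {ν : Measure St} {p : Fin K → ℝ}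

/-- The exponential moment of the age norm stays bounded. -/
lemma lintegral_exp_ageNorm_le [IsProbabilityMeasure P] [IsProbabilityMeasure ν]
    (hX : ∀ k, Measurable (fun s => X s k))
    (hE : IsEnvironment P ν p T S G) (hA : IsAgeBasedUCB X I η T S G A)
    {m : Fin K → Measure ℕ} [∀ k, IsProbabilityMeasure (m k)] (hm : ∀ k l, P.map (G k l) = m k)
    (hG : ∀ k, GeomLaw (p k) (m k)) (σ : PMF Act)
    {χ : Fin K → ℝ} {γ θ r b : ℝ} (hK : 0 < K) (hγ : 0 < γ) (hη : 0 < η) (hχ : ∀ k, 0 < χ k)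
    (hχp : ∀ k, χ k ≤ p k) (hpx : ∀ k, p k + γ / 2 ≤ channelRate ν X k)
    (hσ : ∀ k, (p k + γ / 2) / channelRate ν X k ≤
      ∑' a, (σ a).toReal * ((I a k).toNat : ℝ))
    (hθ : 0 < θ) (hs : ∀ k, 0 < 1 - (1 - χ k) * Real.exp (2 * θ / channelRate ν X k))
    (hr : 0 ≤ r) (hrθ : r ≤ θ)
    (hb0 : 0 ≤ 1 - r * (γ / 4) + 2 * (r / θ) ^ 2 * mgfProd (channelRate ν X) χ θ)
    (hb : (1 - r * (γ / 4) + 2 * (r / θ) ^ 2 * mgfProd (channelRate ν X) χ θ) * b +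
      mgfProd (channelRate ν X) χ θ *
        Real.exp (r * (4 / γ * (K * η + ∑ k, 1 / (χ k * channelRate ν X k)))) ≤ b)
    (hb1 : 1 ≤ b) {t : ℕ} (ht : 1 ≤ t) (htT : t ≤ T + 1) :
    ∫⁻ ω, ENNReal.ofReal (Real.exp (r * ageNorm (fun k => p k / channelRate ν X k)
      (ageAt X I S G A t ω))) ∂P ≤ ENNReal.ofReal b := by
  set x := channelRate ν X
  set c : Fin K → ℝ := fun k => p k / x k
  set a₀ := 4 / γ * (K * η + ∑ k, 1 / (χ k * x k))
  set ρ := 1 - r * (γ / 4) + 2 * (r / θ) ^ 2 * mgfProd x χ θ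
  have hp : ∀ k, 0 < p k := fun k => (hχ k).trans_le (hχp k)
  have hpx' : ∀ k, p k < x k := fun k => by have := hpx k; linarith
  have hx : ∀ k, 0 < x k := fun k => (hp k).trans (hpx' k)
  have hx1 : ∀ k, x k ≤ 1 := fun k => channelRate_le_one hX k
  have hc : ∀ k, 0 ≤ c k := fun k => (div_pos (hp k) (hx k)).le
  have hg0 : 0 ≤ mgfProd x χ θ := (Real.exp_pos _).le.trans
    (exp_le_mgfProd hK (fun k => (hχp k).trans ((hpx' k).le.trans (hx1 k))) hx hx1 hθ hs)
  have ha₀ : 0 < a₀ := by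
    have : (0 : ℝ) < K := by exact_mod_cast hK
    have : 0 ≤ ∑ k, 1 / (χ k * x k) := Finset.sum_nonneg fun k _ => by
      have := hχ k; have := hx k; positivity
    positivity
  induction t, ht using Nat.le_induction with
  | base =>
    have h1 : ∀ᵐ ω ∂P, ∀ k, 1 ≤ G k 0 ω := by
      rw [ae_all_iff]
      intro k
      have := (hG k).ae_pos
      rw [← hm k 0] at this
      exact ae_of_ae_map (hE.gap_measurable k 0).aemeasurable this
    have h2 : ∀ᵐ ω ∂P, ENNReal.ofReal (Real.exp (r * ageNorm c (ageAt X I S G A 1 ω))) ≤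
        ENNReal.ofReal b := by
      filter_upwards [h1] with ω hω
      have e : ageAt X I S G A 1 ω = fun _ => 0 := funext fun k => by
        have := hω k
        have h3 : ageAt X I S G A 1 ω k = 1 - G k 0 ω := headAge_one_le _ _
        omega
      refine ENNReal.ofReal_le_ofReal ?_
      simpa [e, ageNorm] using hb1
    exact (lintegral_mono_ae h2).trans (by simp)
  | succ t ht ih =>
    have htm : t ∈ Finset.Icc 1 T := by simp; omega
    have ht' : t ≤ T + 1 := by omega
    let F : Ω → St × (Fin K → ℕ) → ENNReal := fun ω q => ENNReal.ofReal (Real.exp (r *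
      ageNorm c (nextAge (ageAt X I S G A t ω) (fun k => X q.1 k && I (A t ω) k) q.2)))
    have hF := lintegral_revealed_fresh hX hE hA hm htm (F := F)
      (fun ω => measurable_of_channel_gaps hX fun q => ENNReal.ofReal (Real.exp (r *
        ageNorm c (nextAge (ageAt X I S G A t ω) (fun k => q.1 k && I (A t ω) k) q.2))))
      fun ω ω' h => by
        simp only [F, ageAt_eq_of_revealed_eq hA ht' h, action_eq_of_revealed_eq hA htm h]
    -- Above the level `a₀` the exponential contracts by `ρ`; below it, it grows at most by the
    -- factor `g(χ, θ)` from at most `exp (r a₀)`. The sum of the two bounds covers both cases.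
    have hstep : ∀ ω, ∫⁻ q, F ω q ∂(ν.prod (Measure.pi m)) ≤
        ENNReal.ofReal ρ * ENNReal.ofReal (Real.exp (r * ageNorm c (ageAt X I S G A t ω))) +
          ENNReal.ofReal (mgfProd x χ θ * Real.exp (r * a₀)) := fun ω => by
      rw [← ENNReal.ofReal_mul hb0]
      rcases le_or_gt a₀ (ageNorm c (ageAt X I S G A t ω)) with hle | hlt
      · refine le_trans ?_ (le_add_right le_rfl)
        exact lintegral_exp_ageNorm_nextAge_le hX hG hγ hχ hχp hpx hθ hs
          (sum_headAge_mul_le hη.le σ (hA.argmax t htm ω) hσ) (ha₀.trans_le hle) hle hr hrθ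
      · refine le_trans ?_ (le_add_left le_rfl)
        refine (lintegral_exp_ageNorm_nextAge_le_mgfProd hX hG hχ hχp hpx' hθ hs _ _ hr hrθ).trans
          (ENNReal.ofReal_le_ofReal ?_)
        gcongr
    calc _ ≤ ∫⁻ ω, F ω (freshAt X I S G A t ω) ∂P := by
          refine lintegral_mono fun ω => ENNReal.ofReal_le_ofReal (Real.exp_le_exp.2 ?_)
          exact mul_le_mul_of_nonneg_left (ageNorm_mono hc (ageAt_succ_le_nextAge ht ω)) hr
      _ = ∫⁻ ω, ∫⁻ q, F ω q ∂(ν.prod (Measure.pi m)) ∂P := hF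
      _ ≤ _ := lintegral_mono hstep
      _ = ENNReal.ofReal ρ *
          ∫⁻ ω, ENNReal.ofReal (Real.exp (r * ageNorm c (ageAt X I S G A t ω))) ∂P +
          ENNReal.ofReal (mgfProd x χ θ * Real.exp (r * a₀)) := by
        rw [lintegral_add_right _ measurable_const, lintegral_const_mul' _ _ ENNReal.ofReal_ne_top,
          lintegral_const, measure_univ, mul_one]
      _ ≤ ENNReal.ofReal ρ * ENNReal.ofReal b +
          ENNReal.ofReal (mgfProd x χ θ * Real.exp (r * a₀)) := by gcongr; exact ih ht'
      _ = ENNReal.ofReal (ρ * b + mgfProd x χ θ * Real.exp (r * a₀)) := by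
        rw [← ENNReal.ofReal_mul hb0, ← ENNReal.ofReal_add (mul_nonneg hb0 (by linarith))
          (by positivity)]
      _ ≤ ENNReal.ofReal b := ENNReal.ofReal_le_ofReal hb

/-- Jensen's inequality for the logarithm, in the form needed here. -/
lemma lintegral_le_log_div [IsProbabilityMeasure P] {f : Ω → ℝ}
    (hf0 : ∀ ω, 0 ≤ f ω) {r b : ℝ} (hr : 0 < r) (hb : 1 ≤ b)
    (h : ∫⁻ ω, ENNReal.ofReal (Real.exp (r * f ω)) ∂P ≤ ENNReal.ofReal b) :
    ∫⁻ ω, ENNReal.ofReal (f ω) ∂P ≤ ENNReal.ofReal (Real.log b / r) := by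
  have hb0 : 0 < b := by linarith
  have h1 : ∀ ω, ENNReal.ofReal (f ω) + ENNReal.ofReal (1 / r) ≤ ENNReal.ofReal (Real.log b / r) +
      ENNReal.ofReal (1 / (r * b)) * ENNReal.ofReal (Real.exp (r * f ω)) := fun ω => by
    have hl := Real.log_nonneg hb
    rw [← ENNReal.ofReal_mul (by positivity), ← ENNReal.ofReal_add (hf0 ω) (by positivity),
      ← ENNReal.ofReal_add (by positivity) (by positivity)]
    refine ENNReal.ofReal_le_ofReal ?_
    -- Tangent line of the exponential at `log b`; integrating it gives Jensen's inequality.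
    have h2 := Real.add_one_le_exp (r * f ω - Real.log b)
    rw [Real.exp_sub, Real.exp_log hb0] at h2
    have e1 : f ω + 1 / r = (r * f ω + 1) / r := by field_simp
    have e2 : Real.log b / r + 1 / (r * b) * Real.exp (r * f ω) =
      (Real.log b + Real.exp (r * f ω) / b) / r := by field_simp
    rw [e1, e2]
    exact div_le_div_of_nonneg_right (by linarith) hr.le
  have h2 := lintegral_mono (μ := P) h1
  rw [lintegral_add_right _ measurable_const, lintegral_add_left measurable_const,
    lintegral_const_mul' _ _ ENNReal.ofReal_ne_top] at h2
  simp only [lintegral_const, measure_univ, mul_one] at h2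
  have h3 : ENNReal.ofReal (1 / (r * b)) * ∫⁻ ω, ENNReal.ofReal (Real.exp (r * f ω)) ∂P ≤
      ENNReal.ofReal (1 / r) := by
    calc _ ≤ ENNReal.ofReal (1 / (r * b)) * ENNReal.ofReal b := by gcongr
      _ = _ := by
        rw [← ENNReal.ofReal_mul (by positivity)]
        congr 1
        field_simp
  exact (ENNReal.add_le_add_iff_right ENNReal.ofReal_ne_top).1
    (h2.trans (add_le_add_right h3 _))

/-- With `a = log (4 / γ)` and `b = log (32 g / θ²)`, the logarithm on the left is `b + log g + 2 a
- log 4 ≤ 3 b + 2 a ≤ (9/2) a b`, as `a` and `b` are bounded below. The constants match since `16 ·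
9/2 = 8 · 9`. -/
lemma log_le_of_window {γ θ g : ℝ} (hγ : 0 < γ) (hγ1 : γ ≤ 1) (hθ : 0 < θ)
    (hg : Real.exp (2 * θ) ≤ g) :
    16 * g / (γ * θ ^ 2) * Real.log (128 * g ^ 2 / (γ ^ 2 * θ ^ 2)) ≤
      8 * Real.log (4 / γ) / γ * (9 * g / θ ^ 2 * Real.log (32 * g / θ ^ 2)) := by
  have hg0 : 0 < g := (Real.exp_pos _).trans_le hg
  have hq := Real.quadratic_le_exp_of_nonneg (x := 2 * θ) (by positivity)
  have hgθ : 2 * θ ^ 2 ≤ g := by nlinarith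
  have hg1 : 1 ≤ g := by nlinarith [sq_nonneg θ]
  -- `a` and `b` are the two logarithms of the bound
  set a := Real.log (4 / γ)
  set b := Real.log (32 * g / θ ^ 2)
  have hlog2 : 0.69 < Real.log 2 := by linarith [Real.log_two_gt_d9]
  have ha : 1.38 ≤ a := by
    have h1 : Real.log 4 ≤ a := Real.log_le_log (by norm_num) (by
      rw [le_div_iff₀ hγ]; linarith)
    have h2 : Real.log 4 = 2 * Real.log 2 := by
      rw [show (4 : ℝ) = 2 ^ 2 by norm_num, Real.log_pow]; norm_num
    linarith
  have hb : 4.1 ≤ b := by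
    have h1 : Real.log 64 ≤ b := Real.log_le_log (by norm_num) (by
      rw [le_div_iff₀ (by positivity)]; linarith)
    have h2 : Real.log 64 = 6 * Real.log 2 := by
      rw [show (64 : ℝ) = 2 ^ 6 by norm_num, Real.log_pow]; norm_num
    linarith
  have hlogg : Real.log g ≤ 2 * b := by
    rw [show 2 * b = Real.log ((32 * g / θ ^ 2) ^ 2) by rw [Real.log_pow]; norm_num; rfl]
    refine Real.log_le_log hg0 ?_
    rw [div_pow, le_div_iff₀ (by positivity)]
    -- The fourth-order term of `exp (2 θ)` gives `θ⁴ ≤ 1024 g`, that is `g ≤ (32 g / θ²)²`.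
    have h4 : (2 * θ) ^ 4 / 24 ≤ g := by
      have := Real.pow_div_factorial_le_exp (x := 2 * θ) (by positivity) 4
      norm_num [Nat.factorial] at this
      linarith
    nlinarith
  have hL : Real.log (128 * g ^ 2 / (γ ^ 2 * θ ^ 2)) ≤ 3 * b + 2 * a := by
    have e : 128 * g ^ 2 / (γ ^ 2 * θ ^ 2) ≤ (32 * g / θ ^ 2) * g * (4 / γ) ^ 2 := by
      rw [show (32 * g / θ ^ 2) * g * (4 / γ) ^ 2 = 4 * (128 * g ^ 2 / (γ ^ 2 * θ ^ 2)) by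
        field_simp; norm_num]
      have : 0 ≤ 128 * g ^ 2 / (γ ^ 2 * θ ^ 2) := by positivity
      linarith
    have h1 := Real.log_le_log (by positivity) e
    rw [Real.log_mul (by positivity) (by positivity), Real.log_mul (by positivity) hg0.ne',
      Real.log_pow] at h1
    push_cast at h1
    linarith
  have hab : 3 * b + 2 * a ≤ 9 / 2 * (a * b) := by nlinarith
  calc 16 * g / (γ * θ ^ 2) * Real.log (128 * g ^ 2 / (γ ^ 2 * θ ^ 2))
      ≤ 16 * g / (γ * θ ^ 2) * (9 / 2 * (a * b)) := by gcongr; exact hL.trans hab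
    _ = _ := by field_simp; ring

/-- The mean age norm is bounded uniformly in time, for every admissible `θ`. -/
lemma lintegral_ageNorm_le [IsProbabilityMeasure P] [IsProbabilityMeasure ν]
    (hX : ∀ k, Measurable (fun s => X s k))
    (hE : IsEnvironment P ν p T S G) (hA : IsAgeBasedUCB X I η T S G A)
    {m : Fin K → Measure ℕ} [∀ k, IsProbabilityMeasure (m k)] (hm : ∀ k l, P.map (G k l) = m k)
    (hG : ∀ k, GeomLaw (p k) (m k)) (σ : PMF Act)
    {χ : Fin K → ℝ} {γ θ : ℝ} (hK : 0 < K) (hγ : 0 < γ) (hγ1 : γ ≤ 1) (hη : 0 < η)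
    (hχ : ∀ k, 0 < χ k)
    (hχp : ∀ k, χ k ≤ p k) (hpx : ∀ k, p k + γ / 2 ≤ channelRate ν X k)
    (hσ : ∀ k, (p k + γ / 2) / channelRate ν X k ≤
      ∑' a, (σ a).toReal * ((I a k).toNat : ℝ))
    (hθ : 0 < θ) (hs : ∀ k, 0 < 1 - (1 - χ k) * Real.exp (2 * θ / channelRate ν X k))
    {t : ℕ} (ht : 1 ≤ t) (htT : t ≤ T + 1) :
    ∫⁻ ω, ENNReal.ofReal (ageNorm (fun k => p k / channelRate ν X k)
      (ageAt X I S G A t ω)) ∂P ≤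
    ENNReal.ofReal (4 / γ * (K * η + ∑ k, 1 / (χ k * channelRate ν X k)) +
      8 * Real.log (4 / γ) / γ * (9 * mgfProd (channelRate ν X) χ θ / θ ^ 2 *
        Real.log (32 * mgfProd (channelRate ν X) χ θ / θ ^ 2))) := by
  set a₀ := 4 / γ * (K * η + ∑ k, 1 / (χ k * channelRate ν X k))
  have hp : ∀ k, 0 < p k := fun k => (hχ k).trans_le (hχp k)
  have hpx' : ∀ k, p k < channelRate ν X k := fun k => by have := hpx k; linarith
  have hx : ∀ k, 0 < channelRate ν X k := fun k => (hp k).trans (hpx' k)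
  have hx1 : ∀ k, channelRate ν X k ≤ 1 := fun k => channelRate_le_one hX k
  have hg := exp_le_mgfProd hK (fun k => (hχp k).trans ((hpx' k).le.trans (hx1 k))) hx hx1 hθ hs
  have ha₀ : 0 ≤ a₀ := by
    have : 0 ≤ ∑ k, 1 / (χ k * channelRate ν X k) := Finset.sum_nonneg fun k _ => by
      have := hχ k; have := hx k; positivity
    positivity
  have hlog := log_le_of_window hγ hγ1 hθ hg
  set g := mgfProd (channelRate ν X) χ θ with hgdef
  have hg0 : 0 < g := (Real.exp_pos _).trans_le hg
  have hq := Real.quadratic_le_exp_of_nonneg (x := 2 * θ) (by positivity)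
  have hgθ : 2 * θ ^ 2 ≤ g := by nlinarith
  have hgθ' : θ ≤ g := by nlinarith [sq_nonneg θ]
  have hg1 : 1 ≤ g := by nlinarith [sq_nonneg θ]
  -- This `r` minimizes the factor `1 - r γ / 4 + 2 (r / θ)² g`, with minimum `1 - γ² θ² / (128 g)`.
  let r := γ * θ ^ 2 / (16 * g)
  have hr : 0 < r := by positivity
  have hrθ : r ≤ θ := by
    rw [div_le_iff₀ (by positivity)]
    have : γ * θ ≤ 16 * g := by nlinarith
    nlinarith
  have hρ : 1 - r * (γ / 4) + 2 * (r / θ) ^ 2 * g = 1 - γ ^ 2 * θ ^ 2 / (128 * g) := by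
    simp only [r]; field_simp; ring
  have hγθ : γ ^ 2 * θ ^ 2 ≤ g := by
    have : γ ^ 2 ≤ 1 := pow_le_one₀ hγ.le hγ1
    nlinarith [sq_nonneg θ]
  have hρ0 : 0 ≤ 1 - γ ^ 2 * θ ^ 2 / (128 * g) := by
    rw [sub_nonneg, div_le_one (by positivity)]; linarith
  -- The fixed point of `b = ρ b + g exp (r a₀)`, where `ρ` is the minimal factor.
  let b := 128 * g ^ 2 / (γ ^ 2 * θ ^ 2) * Real.exp (r * a₀)
  have hfac : 1 ≤ 128 * g ^ 2 / (γ ^ 2 * θ ^ 2) := by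
    rw [le_div_iff₀ (by positivity)]; nlinarith
  have hb1 : 1 ≤ b := one_le_mul_of_one_le_of_one_le hfac (Real.one_le_exp (by positivity))
  have hexp := lintegral_exp_ageNorm_le hX hE hA hm hG σ hK hγ hη hχ hχp hpx hσ hθ hs hr.le hrθ
    (b := b) (by rw [← hgdef, hρ]; exact hρ0) (le_of_eq (by
      rw [← hgdef, hρ]; simp only [b, a₀]; field_simp; ring)) hb1 ht htT
  refine (lintegral_le_log_div
    (fun ω => ageNorm_nonneg _ _) hr hb1 hexp).trans (ENNReal.ofReal_le_ofReal ?_)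
  have e : Real.log b / r =
      a₀ + 16 * g / (γ * θ ^ 2) * Real.log (128 * g ^ 2 / (γ ^ 2 * θ ^ 2)) := by
    simp only [b]
    rw [Real.log_mul (by positivity) (Real.exp_pos _).ne', Real.log_exp]
    simp only [r]; field_simp; ring
  rw [e]
  linarith

end Stability

/-! ### From bounded ages to throughput in a window -/

section Main

variable {K : ℕ} {Ω St Act : Type*} [MeasurableSpace Ω] [MeasurableSpace St]
  {X : St → Fin K → Bool} {I : Act → Fin K → Bool} {η : ℝ} {T : ℕ} {S : ℕ → Ω → St}
  {G : Fin K → ℕ → Ω → ℕ} {A : ℕ → Ω → Act} {P : Measure Ω} {ν : Measure St} {p : Fin K → ℝ}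

/-- The minimum in `f(χ)` is over a nonempty set. -/
lemma exists_admissible {x χ : Fin K → ℝ} (hK : 0 < K) (hx : ∀ k, 0 < x k)
    (hχ : ∀ k, 0 < χ k) (hχ1 : ∀ k, χ k < 1) :
    {θ : ℝ | 0 < θ ∧ θ ≤ thetaMax x χ ∧
      ∀ k, 0 < 1 - (1 - χ k) * Real.exp (2 * θ / x k)}.Nonempty := by
  have : Nonempty (Fin K) := ⟨⟨0, hK⟩⟩
  obtain ⟨i, hi⟩ := exists_eq_ciInf_of_finite (f := x)
  obtain ⟨j, hj⟩ := exists_eq_ciInf_of_finite (f := χ)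
  have hxi : ∀ k, x i ≤ x k := fun k => hi ▸ ciInf_le (Set.finite_range x).bddBelow k
  have hχj : ∀ k, χ j ≤ χ k := fun k => hj ▸ ciInf_le (Set.finite_range χ).bddBelow k
  have hL : Real.log (1 - χ j) < 0 := Real.log_neg (by linarith [hχ1 j]) (by linarith [hχ j])
  have hmax : thetaMax x χ = -(x i / 2) * Real.log (1 - χ j) := by rw [thetaMax, ← hi, ← hj]
  have hpos : 0 < thetaMax x χ := by
    rw [hmax]; nlinarith [mul_pos (hx i) (neg_pos.2 hL)]
  -- At `θ = h(χ)` a denominator may vanish; half of it keeps all of them positive.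
  refine ⟨thetaMax x χ / 2, by linarith, by linarith, fun k => ?_⟩
  have h1 : 2 * (thetaMax x χ / 2) / x k < -Real.log (1 - χ j) := by
    rw [div_lt_iff₀ (hx k), hmax]
    nlinarith [mul_pos (hx i) (neg_pos.2 hL), mul_le_mul_of_nonneg_left (hxi k) (neg_pos.2 hL).le]
  have h2 := Real.exp_lt_exp.2 h1
  rw [Real.exp_neg, Real.exp_log (by linarith [hχ1 j])] at h2
  have h3 : 0 < 1 - χ j := by linarith [hχ1 j]
  have h4 : (1 - χ j) * Real.exp (2 * (thetaMax x χ / 2) / x k) < 1 := by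
    calc _ < (1 - χ j) * (1 - χ j)⁻¹ := by gcongr
      _ = 1 := mul_inv_cancel₀ h3.ne'
  nlinarith [hχj k, Real.exp_pos (2 * (thetaMax x χ / 2) / x k)]

/-- Since `p x ≤ 1`, `p² ≤ p / x`. This bounds the term `p Z` lost in Wald's identity. -/
lemma mul_age_le_ageNorm {x : Fin K → ℝ} (hp : ∀ k, 0 < p k) (hpx : ∀ k, p k ≤ x k)
    (hx1 : ∀ k, x k ≤ 1) (z : Fin K → ℕ) (k : Fin K) :
    p k * z k ≤ ageNorm (fun k => p k / x k) z := by
  have hx : ∀ k, 0 < x k := fun k => (hp k).trans_le (hpx k)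
  refine le_trans ?_ (sqrt_mul_le_ageNorm (fun k => (div_pos (hp k) (hx k)).le) z k)
  refine mul_le_mul_of_nonneg_right (Real.le_sqrt_of_sq_le ?_) (Nat.cast_nonneg _)
  rw [le_div_iff₀ (hx k)]
  have h1 := hp k
  have h2 := hpx k
  have h3 := hx1 k
  have : p k * x k ≤ 1 := by nlinarith
  nlinarith

lemma windowBound_eq {x χ : Fin K → ℝ} {γ η ε : ℝ} (hγ : γ ≠ 0) (hε : ε ≠ 0) :
    windowBound x χ γ η ε = (8 * Real.log (4 / γ) / γ * windowConst x χ +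
      4 / γ * (K * η + ∑ k, 1 / (χ k * x k)) + 1) / ε := by
  unfold windowBound
  field_simp
  ring

/-- Expected rewards in a window, from Wald's identity. -/
lemma mul_window_le_integral_sum [IsProbabilityMeasure P] [IsProbabilityMeasure ν]
    (hX : ∀ k, Measurable (fun s => X s k))
    (hE : IsEnvironment P ν p T S G) (hA : IsAgeBasedUCB X I η T S G A)
    {m : Fin K → Measure ℕ} [∀ k, IsProbabilityMeasure (m k)] (hm : ∀ k l, P.map (G k l) = m k)
    (hG : ∀ k, GeomLaw (p k) (m k)) (hp : ∀ k, 0 < p k) (hp1 : ∀ k, p k < 1) (k : Fin K)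
    {t W : ℕ} (hW : 1 ≤ W) (hWt : W ≤ t) (htT : t ≤ T) {M : ℝ} (hM : 0 ≤ M)
    (hage : ENNReal.ofReal (p k) * ∫⁻ ω, (ageAt X I S G A (t + 1) ω k : ENNReal) ∂P ≤
      ENNReal.ofReal M) :
    p k * W - M - 1 ≤
      ∫ ω, ∑ τ ∈ Finset.Icc (t + 1 - W) t, ((rewardsAt X I S A ω k τ).toNat : ℝ) ∂P := by
  set s := t + 1 - W with hs
  have hs1 : 1 ≤ s := by omega
  have hsT : s ≤ T + 1 := by omega
  have hmeas : ∀ u, u ≤ T + 1 → Measurable fun ω => (headIndex X I S G A u ω k : ℝ) :=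
    fun u hu => measurable_of_revealed hX hE hA hu fun ω ω' h => by
      rw [headIndex_eq_of_revealed_eq hA hu h]
  have hint : ∀ u, 1 ≤ u → u ≤ T + 1 →
      Integrable (fun ω => (headIndex X I S G A u ω k : ℝ)) P := fun u hu1 hu =>
    Integrable.of_bound (hmeas u hu).aestronglyMeasurable u (ae_of_all _ fun ω => by
      rw [Real.norm_of_nonneg (Nat.cast_nonneg _)]
      exact_mod_cast nextToDepart_le _ _ hu1)
  have hreal : ∀ u, 1 ≤ u → u ≤ T + 1 → ENNReal.ofReal (∫ ω, (headIndex X I S G A u ω k : ℝ) ∂P) =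
      ∫⁻ ω, (headIndex X I S G A u ω k : ENNReal) ∂P := fun u hu1 hu => by
    rw [ofReal_integral_eq_lintegral_ofReal (hint u hu1 hu)
      (ae_of_all _ fun _ => Nat.cast_nonneg _)]
    simp
  -- upper bound at the start of the window
  have hstart : ∫ ω, (headIndex X I S G A s ω k : ℝ) ∂P ≤ 1 + (t - W : ℝ) * p k := by
    have h := lintegral_nextToDepart_le (P := P) (g := G k) (m := m k)
      (fun l => hE.gap_measurable k l)
      (hE.gap_indep.precomp (g := fun l : ℕ => (k, l)) fun a b h => (Prod.ext_iff.1 h).2)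
      (hm k) (hG k) (hp k) (hp1 k) (fun ω => rewardsAt X I S A ω k) hs1
    have h' : ENNReal.ofReal (∫ ω, (headIndex X I S G A s ω k : ℝ) ∂P) ≤
        ENNReal.ofReal (1 + (t - W : ℝ) * p k) := by
      rw [hreal s hs1 hsT]
      refine h.trans_eq ?_
      have e : s - 1 = t - W := by omega
      have hWt' : (W : ℝ) ≤ t := by exact_mod_cast hWt
      rw [e, ENNReal.ofReal_add zero_le_one (mul_nonneg (by linarith) (hp k).le),
        ENNReal.ofReal_mul (by linarith), ← Nat.cast_sub hWt, ENNReal.ofReal_natCast,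
        ENNReal.ofReal_one]
    refine (ENNReal.ofReal_le_ofReal_iff ?_).1 h'
    have hWt' : (W : ℝ) ≤ t := by exact_mod_cast hWt
    have := mul_nonneg (sub_nonneg.2 hWt') (hp k).le
    linarith
  -- lower bound at the end of the window
  have hend : p k * (t + 1) - M ≤ ∫ ω, (headIndex X I S G A (t + 1) ω k : ℝ) ∂P := by
    have hw := lintegral_headIndex_eq hX hE hA hm hG hp hp1 k (t := t + 1) (by omega) (by omega)
    -- Slot `t + 1` is at most the age plus the arrival time of the current request; Wald's identity
    -- converts the latter into the position.
    have h1 : ((t + 1 : ℕ) : ENNReal) ≤ ∫⁻ ω, (ageAt X I S G A (t + 1) ω k : ENNReal) ∂P +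
        ∫⁻ ω, (arrivalTime (fun l => G k l ω) (headIndex X I S G A (t + 1) ω k) : ENNReal) ∂P := by
      rw [← lintegral_add_left (measurable_of_revealed hX hE hA (t := t + 1) (by omega)
        fun ω ω' h => by rw [ageAt_eq_of_revealed_eq hA (by omega) h])]
      calc ((t + 1 : ℕ) : ENNReal) = ∫⁻ _, ((t + 1 : ℕ) : ENNReal) ∂P := by simp
        _ ≤ _ := lintegral_mono fun ω => by
          have h : t + 1 ≤ ageAt X I S G A (t + 1) ω k +
              arrivalTime (fun l => G k l ω) (headIndex X I S G A (t + 1) ω k) :=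
            le_headAge_add_arrivalTime _ _ (t + 1)
          exact (Nat.cast_le.2 h).trans_eq (Nat.cast_add _ _)
    have h2 : ENNReal.ofReal (p k * (t + 1)) ≤
        ENNReal.ofReal (M + ∫ ω, (headIndex X I S G A (t + 1) ω k : ℝ) ∂P) := by
      rw [ENNReal.ofReal_add hM (integral_nonneg fun _ => Nat.cast_nonneg _),
        hreal (t + 1) (by omega) (by omega), hw, ENNReal.ofReal_mul (hp k).le]
      calc ENNReal.ofReal (p k) * ENNReal.ofReal (t + 1) =
            ENNReal.ofReal (p k) * ((t + 1 : ℕ) : ENNReal) := by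
              rw [← ENNReal.ofReal_natCast]; push_cast; rfl
        _ ≤ _ := mul_le_mul_right h1 _
        _ ≤ _ := by rw [mul_add]; gcongr
    have h3 : 0 ≤ ∫ ω, (headIndex X I S G A (t + 1) ω k : ℝ) ∂P :=
      integral_nonneg fun _ => Nat.cast_nonneg _
    have := (ENNReal.ofReal_le_ofReal_iff (by linarith)).1 h2
    linarith
  have hrm : ∀ τ ∈ Finset.Icc s t, Integrable
      (fun ω => ((rewardsAt X I S A ω k τ).toNat : ℝ)) P := fun τ hτ => by
    have hτ' := Finset.mem_Icc.1 hτ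
    refine Integrable.of_bound (measurable_of_revealed hX hE hA (t := τ + 1) (by omega)
      fun ω ω' h => ?_).aestronglyMeasurable 1 (ae_of_all _ fun ω => ?_)
    · rw [rewardsAt_eq_of_revealed_eq hA (by omega) h k (by simp; omega)]
    · rw [Real.norm_of_nonneg (Nat.cast_nonneg _)]
      exact toNat_le_one _
  have hmono : ∫ ω, ((headIndex X I S G A (t + 1) ω k : ℝ) - headIndex X I S G A s ω k) ∂P ≤
      ∫ ω, ∑ τ ∈ Finset.Icc s t, ((rewardsAt X I S A ω k τ).toNat : ℝ) ∂P := by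
    refine integral_mono ((hint _ (by omega) (by omega)).sub (hint s hs1 hsT))
      (integrable_finsetSum _ hrm) fun ω => ?_
    have h := nextToDepart_le_add_sum (fun l => G k l ω) (rewardsAt X I S A ω k)
      (s := s) (t := t) (by omega)
    have h' : (headIndex X I S G A (t + 1) ω k : ℝ) ≤ headIndex X I S G A s ω k +
        ∑ τ ∈ Finset.Icc s t, ((rewardsAt X I S A ω k τ).toNat : ℝ) := by exact_mod_cast h
    change (headIndex X I S G A (t + 1) ω k : ℝ) - headIndex X I S G A s ω k ≤ _
    linarith
  rw [integral_sub (hint _ (by omega) (by omega)) (hint s hs1 hsT)] at hmono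
  have := hp k
  linarith

/-- The throughput guarantee. -/
lemma le_integral_throughput [IsProbabilityMeasure P] [IsProbabilityMeasure ν]
    (hX : ∀ k, Measurable (fun s => X s k)) {χ : Fin K → ℝ} (hχ : ∀ k, 0 < χ k) {γ : ℝ}
    (hγ : 0 < γ) (hγ1 : γ ≤ 1) (σ : PMF Act)
    (hσ : ∀ k, χ k + γ ≤ channelRate ν X k * ∑' a, (σ a).toReal * ((I a k).toNat : ℝ))
    {ε : ℝ} {W : ℕ} (hη : 0 < η) (hε : 0 < ε) (hεγ : ε ≤ γ / 2)
    (hW : windowBound (channelRate ν X) χ γ η ε ≤ W)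
    (hE : IsEnvironment P ν (fun k => χ k + ε) T S G) (hA : IsAgeBasedUCB X I η T S G A)
    (k : Fin K) {t : ℕ} (hWt : W ≤ t) (htT : t ≤ T) :
    χ k ≤ ∫ ω, throughput W (rewardsAt X I S A ω k) t ∂P := by
  have hK : 0 < K := k.pos
  set p : Fin K → ℝ := fun k => χ k + ε
  have hp : ∀ k, 0 < p k := fun k => add_pos (hχ k) hε
  have hx1 : ∀ k, channelRate ν X k ≤ 1 := fun k => channelRate_le_one hX k
  have hσ1 : ∀ k, ∑' a, (σ a).toReal * ((I a k).toNat : ℝ) ≤ 1 := fun k =>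
    tsum_pmf_toNat_le_one σ fun a => I a k
  have hx0 := channelRate_nonneg ν X
  have hpx : ∀ k, p k + γ / 2 ≤ channelRate ν X k := fun k => by
    have h1 := mul_le_of_le_one_right (hx0 k) (hσ1 k)
    have h2 := hσ k
    simp only [p]; linarith
  have hpx' : ∀ k, p k < channelRate ν X k := fun k => by have := hpx k; linarith
  have hx : ∀ k, 0 < channelRate ν X k := fun k => (hp k).trans (hpx' k)
  have hp1 : ∀ k, p k < 1 := fun k => (hpx' k).trans_le (hx1 k)
  have hχp : ∀ k, χ k ≤ p k := fun k => by simp only [p]; linarith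
  -- Slater's slack `γ` is split: `ε ≤ γ / 2` raises the arrival rates, and `γ / 2` remains as
  -- drift.
  have hσ' : ∀ k, (p k + γ / 2) / channelRate ν X k ≤
      ∑' a, (σ a).toReal * ((I a k).toNat : ℝ) := fun k => by
    rw [div_le_iff₀ (hx k), mul_comm]
    refine le_trans ?_ (hσ k)
    simp only [p]; linarith
  let m : Fin K → Measure ℕ := fun k => P.map (G k 0)
  have hGl : ∀ k l, GeomLaw (p k) (P.map (G k l)) := fun k l =>
    isGeometric_geomLaw (hp k) (hp1 k) (hE.gap_measurable k l) (hE.gap_law k l)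
  have hG : ∀ k, GeomLaw (p k) (m k) := fun k => hGl k 0
  have hm : ∀ k l, P.map (G k l) = m k := fun k l => (hGl k l).ext (hG k)
  have hprob : ∀ k, IsProbabilityMeasure (m k) := fun k =>
    (hG k).isProbabilityMeasure (hp k) (hp1 k)
  -- the mean age norm
  set Φ := ∫⁻ ω, ENNReal.ofReal (ageNorm (fun k => p k / channelRate ν X k)
      (ageAt X I S G A (t + 1) ω)) ∂P
  set C := 8 * Real.log (4 / γ) / γ
  set a₀ := 4 / γ * (K * η + ∑ k, 1 / (χ k * channelRate ν X k))
  have hC : 0 < C := by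
    have : 0 < Real.log (4 / γ) := Real.log_pos (by rw [lt_div_iff₀ hγ]; linarith)
    positivity
  have hΦ : ∀ θ, 0 < θ → (∀ k, 0 < 1 - (1 - χ k) * Real.exp (2 * θ / channelRate ν X k)) →
      Φ ≤ ENNReal.ofReal (a₀ + C * (9 * mgfProd (channelRate ν X) χ θ / θ ^ 2 *
        Real.log (32 * mgfProd (channelRate ν X) χ θ / θ ^ 2))) := fun θ hθ hs =>
    lintegral_ageNorm_le hX hE hA hm hG σ hK hγ hγ1 hη hχ hχp hpx hσ' hθ hs
      (by omega) (by omega)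
  obtain ⟨θ₀, hθ₀⟩ := exists_admissible hK hx hχ fun k => (hχp k).trans_lt (hp1 k)
  have hfin : Φ ≠ ⊤ := ne_top_of_le_ne_top ENNReal.ofReal_ne_top (hΦ θ₀ hθ₀.1 hθ₀.2.2)
  -- `Φ` does not depend on `θ`, so the bounds for all admissible `θ` pass to the infimum, attained
  -- or not.
  have hf : (Φ.toReal - a₀) / C ≤ windowConst (channelRate ν X) χ := by
    refine le_csInf (Set.Nonempty.image _ ⟨θ₀, hθ₀⟩) ?_
    rintro _ ⟨θ, ⟨hθ, -, hs⟩, rfl⟩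
    have h := hΦ θ hθ hs
    rw [div_le_iff₀ hC]
    have h2 : Φ.toReal ≤ a₀ + C * (9 * mgfProd (channelRate ν X) χ θ / θ ^ 2 *
        Real.log (32 * mgfProd (channelRate ν X) χ θ / θ ^ 2)) := by
      refine ENNReal.toReal_le_of_le_ofReal ?_ h
      have hg := exp_le_mgfProd hK (fun k => ((hχp k).trans_lt (hp1 k)).le) hx hx1 hθ hs
      have hq := Real.quadratic_le_exp_of_nonneg (x := 2 * θ) (by positivity)
      have hg0 : 0 < mgfProd (channelRate ν X) χ θ := (Real.exp_pos _).trans_le hg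
      have hlog : 0 ≤ Real.log (32 * mgfProd (channelRate ν X) χ θ / θ ^ 2) := by
        refine Real.log_nonneg ?_
        rw [le_div_iff₀ (by positivity)]
        nlinarith
      have : 0 ≤ ∑ k, 1 / (χ k * channelRate ν X k) := Finset.sum_nonneg fun k _ => by
        have := hχ k; have := hx k; positivity
      positivity
    linarith
  -- The excess arrivals `ε W` over the window pay for the mean age norm and the initial position
  -- `1`.
  have hWε : Φ.toReal + 1 ≤ ε * W := by
    rw [windowBound_eq hγ.ne' hε.ne', div_le_iff₀ hε] at hW
    rw [div_le_iff₀ hC] at hf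
    linarith
  have hΦ0 : 0 ≤ Φ.toReal := ENNReal.toReal_nonneg
  have hW1 : 1 ≤ W := by
    rcases Nat.eq_zero_or_pos W with h | h
    · rw [h] at hWε; norm_num at hWε; linarith
    · exact h
  have hage : ENNReal.ofReal (p k) * ∫⁻ ω, (ageAt X I S G A (t + 1) ω k : ENNReal) ∂P ≤
      ENNReal.ofReal Φ.toReal := by
    rw [ENNReal.ofReal_toReal hfin, ← lintegral_const_mul' _ _ ENNReal.ofReal_ne_top]
    refine lintegral_mono fun ω => ?_
    rw [← ENNReal.ofReal_natCast, ← ENNReal.ofReal_mul (hp k).le]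
    exact ENNReal.ofReal_le_ofReal
      (mul_age_le_ageNorm hp (fun k => (hpx' k).le) hx1 _ k)
  have hmain := mul_window_le_integral_sum hX hE hA hm hG hp hp1 k hW1 hWt htT hΦ0 hage
  have hW0 : (0 : ℝ) < W := by exact_mod_cast hW1
  simp only [throughput]
  rw [integral_const_mul, one_div, le_inv_mul_iff₀ hW0]
  refine le_trans ?_ hmain
  simp only [p]
  linarith

/-- The window bound grows at most linearly in `η / ε`. -/
lemma exists_windowBound_le (x χ : Fin K → ℝ) {γ : ℝ} (hγ : 0 < γ) :
    ∃ C : ℝ, ∀ η ε : ℝ, 1 ≤ η → 0 < ε → windowBound x χ γ η ε ≤ C * (η / ε) := by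
  set c := 8 * Real.log (4 / γ) / γ * windowConst x χ + 4 / γ * ∑ k, 1 / (χ k * x k) + 1
  refine ⟨|c| + 4 / γ * K, fun η ε hη hε => ?_⟩
  have h1 : windowBound x χ γ η ε = (c + 4 / γ * K * η) / ε := by
    rw [windowBound_eq hγ.ne' hε.ne']; ring
  rw [h1, ← mul_div_assoc]
  gcongr
  have h2 : c ≤ |c| * η := (le_abs_self c).trans (le_mul_of_one_le_right (abs_nonneg c) hη)
  linarith

end Main

end AgeBandit

theorem mainTheorem2 {K : ℕ} {St Act : Type*} [MeasurableSpace St] [Countable Act]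
    (X : St → Fin K → Bool) (hX : ∀ k, Measurable (fun s => X s k)) (I : Act → Fin K → Bool)
    (ν : Measure St) [IsProbabilityMeasure ν]
    (χ : Fin K → ℝ) (hχ : ∀ k, 0 < χ k) (γ : ℝ) (hγ : 0 < γ) (hγ1 : γ ≤ 1)
    (slater : ∃ σ : PMF Act, ∀ k,
      χ k + γ ≤ AgeBandit.channelRate ν X k * ∑' a, (σ a).toReal * ((I a k).toNat : ℝ)) :
    (∀ (η ε : ℝ) (W T : ℕ), 0 < η → 0 < ε → ε ≤ γ / 2 →
      AgeBandit.windowBound (AgeBandit.channelRate ν X) χ γ η ε ≤ (W : ℝ) →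
      ∀ (Ω : Type*) [MeasurableSpace Ω] (P : Measure Ω) [IsProbabilityMeasure P]
        (S : ℕ → Ω → St) (G : Fin K → ℕ → Ω → ℕ) (A : ℕ → Ω → Act),
        AgeBandit.IsEnvironment P ν (fun k => χ k + ε) T S G →
        AgeBandit.IsAgeBasedUCB X I η T S G A →
        ∀ (k : Fin K) (t : ℕ), W ≤ t → t ≤ T →
          χ k ≤ ∫ ω, AgeBandit.throughput W
            (AgeBandit.rewardPath X I (fun τ => S τ ω) (fun τ => A τ ω) k) t ∂P) ∧
    ∃ C : ℝ, ∀ η ε : ℝ, 1 ≤ η → 0 < ε →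
      AgeBandit.windowBound (AgeBandit.channelRate ν X) χ γ η ε ≤ C * (η / ε) := by
  obtain ⟨σ, hσ⟩ := slater
  refine ⟨fun η ε W T hη hε hεγ hW Ω _ P _ S G A hE hA k t hWt htT => ?_,
    AgeBandit.exists_windowBound_le _ χ hγ⟩
  exact AgeBandit.le_integral_throughput hX hχ hγ hγ1 σ hσ hη hε hεγ hW hE hA k hWt htT
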